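/- All graphs are finite and simple. Let $H_1$ be the graph on five vertices obtained from $K_4$ by adding a vertex joined to exactly one vertex of the $K_4$, and let $H_2$ be the graph obtained from $K_4$ by adding a vertex joined to exactly two vertices of the $K_4$. A Gallai $k$-coloring of $K_n$ is an arbitrary map from the edges of $K_n$ to $\{1,\dots,k\}$ (not every color need be used) for which no triangle has its three edges in three pairwise distinct colors. For graphs $F_1,\dots,F_k$, the Gallai-Ramsey number $GR(F_1,\dots,F_k)$ is the minimum integer $n$ such that every Gallai $k$-coloring of $K_n$ contains, for some $i\in\{1,\dots,k\}$, a (not necessarily induced) copy of $F_i$ all of whose edges have color $i$. For $0\le r\le k$ write $GR_k((k-r)K_3,rH)$ for $GR(F_1,\dots,F_k)$ with $F_1=\dots=F_r=H$ and $F_{r+1}=\dots=F_k=K_3$. Theorem. Let $H\in\{H_1,H_2\}$. For all integers $k\ge 1$ and $r$ with $0\le r\le k$, \[ GR_k((k-r)K_3,rH)=\begin{cases} 5^{(k-r)/2}\cdot 17^{r/2}+1, & \text{if } k-r \text{ and } r \text{ are both even},\\ 2\cdot 5^{(k-r-1)/2}\cdot 17^{r/2}+1, & \text{if } k-r \text{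 is odd and } r \text{ is even},\\ 8\cdot 5^{(k-r-1)/2}\cdot 17^{(r-1)/2}+1, & \text{if } k-r \text{ and } r \text{ are both odd},\\ 4\cdot 5^{(k-r)/2}\cdot 17^{(r-1)/2}+1, & \text{if } k-r \text{ is even and } r \text{ is odd}. \end{cases} \] -/

import Mathlib

open SimpleGraph

/-- `K₄` with a pendant edge: `0, 1, 2, 3` span a `K₄` and the vertex `4` is joined to `0` only. -/
def pendantK4 : SimpleGraph (Fin 5) :=
  fromEdgeSet {s(0, 1), s(0, 2), s(0, 3), s(1, 2), s(1, 3), s(2, 3), s(4, 0)}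

/-- `K₄` with an extra vertex joined to two of its vertices: `0, 1, 2, 3` span a `K₄` and the
vertex `4` is joined to `0` and `1` only. -/
def twoJoinedK4 : SimpleGraph (Fin 5) :=
  fromEdgeSet {s(0, 1), s(0, 2), s(0, 3), s(1, 2), s(1, 3), s(2, 3), s(4, 0), s(4, 1)}

/-- A Gallai coloring of a complete graph: an arbitrary coloring of its edges with no rainbow
triangle, that is, no triangle whose three edges have pairwise distinct colors. -/
def IsGallaiColoring {V K : Type*} (c : TopEdgeLabeling V K) : Prop :=
  ∀ (x y z : V) (hxy : x ≠ y) (hyz : y ≠ z) (hxz : x ≠ z),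
    ¬ (c.get x y hxy ≠ c.get y z hyz ∧ c.get y z hyz ≠ c.get x z hxz ∧
        c.get x y hxy ≠ c.get x z hxz)

/-- A finite graph, recorded as its number `m` of vertices and a simple graph on `Fin m`. -/
abbrev FinGraph : Type := Σ m : ℕ, SimpleGraph (Fin m)

/-- Every Gallai `k`-coloring of `K_n` contains, for some color `i`, a monochromatic copy
(as a not necessarily induced subgraph) of `F i` in color `i`. -/
def GallaiArrows (k : ℕ) (F : Fin k → FinGraph) (n : ℕ) : Prop :=
  ∀ c : TopEdgeLabeling (Fin n) (Fin k), IsGallaiColoring c →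
    ∃ i : Fin k, (F i).2 ⊑ c.labelGraph i

/-- `N` is the Gallai-Ramsey number `GR(F 0, …, F (k - 1))`: the minimum `n` such that every Gallai
`k`-coloring of `K_n` contains a monochromatic copy of `F i` in color `i` for some `i`. In
particular such an `n` exists. -/
def IsGallaiRamseyNumber (k : ℕ) (F : Fin k → FinGraph) (N : ℕ) : Prop :=
  IsLeast {n : ℕ | GallaiArrows k F n} N

/-- The assignment of graphs to the `k` colors denoted `((k - r) K₃, r H)`: the first `r` colors get
`H` and the remaining `k - r` colors get the triangle `K₃`. -/
def trianglesAnd (k r : ℕ) (H : SimpleGraph (Fin 5)) : Fin k → FinGraph :=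
  fun i => if (i : ℕ) < r then ⟨5, H⟩ else ⟨3, completeGraph (Fin 3)⟩

/-!
The extremal number factors as `f(a, r) = g(a) h(r)`, where `a` is the number of colors in which
triangles are forbidden and `r` the number of colors in which one of the two five-vertex graphs is
forbidden: `g` starts `1, 2` and is multiplied by `5` in every second step, `h` starts `1, 4` and is
multiplied by `17` in every second step (`triangleFactor`, `fiveVertexFactor`, `extremal`). As
`pendantK4 ≤ twoJoinedK4`, it suffices to prove the upper bound for colorings avoiding `twoJoinedK4`
and the lower bound with colorings avoiding `pendantK4`.

**Lower bound** (`isAttained`). Pentagons, Paley colorings on 17 vertices and at most one edge are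
substituted into each other. These contain no monochromatic `K₄`, so a single color class may be
innermost with a monochromatic `K₄`, which is too small for a five-vertex graph.

**Upper bound** (`card_le_bound`). This is an induction on the number of vertices, for all choices
of forbidden graphs at once, where in some colors even edges may be forbidden. By Gallai's theorem
(`exists_isGallaiPartition`) there is a partition with only two colors, say red and blue, between
the parts, and one color between any two of them. Inside a part that is joined in red to something
else, the forbidden graph of the color red drops from a five-vertex graph to a triangle, or from a
triangle to an edge. There is one exception: such a part `U` may contain a red triangle if only one
vertex is joined to it in red. Then no other vertex of `U` has a red neighbour in that triangle,
and deleting one vertex of each red triangle leaves at least two thirds of `U`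
(`IsolatedTrianglesOn.exists_triangleFreeOn`).

If some part is joined to its complement in a single color, this gives the bound at once
(`card_le_bound_of_joined`). Otherwise every part sees both colors. If no part contains a red or
blue edge, the parts have at most `f(a, r)` vertices each, for the parameters `a`, `r` of the
remaining colors, and their number is at most `5`, `8` or `17` by the Ramsey numbers
`R(K₃, K₃) = 6`, `R(K₃, H) = 9` and `R(H, H) = 18` (`card_le_five`, `card_le_eight`,
`card_le_seventeen`). If a part does contain such an edge, then the bounds from the induction
hypothesis for it, for the vertices it sees in red and for those it sees in blue add up to the claim
(`IsPart.card_le_of_triangleFreeOn`, `IsPart.card_le_of_not_triangleFreeOn`,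
`IsPart.card_le_of_not_edgeFreeOn`); only the last of these needs the finer estimate
`IsGallaiPartition.card_outside_le`.
-/

namespace GallaiRamsey

variable {V : Type*}

/-! ### Forbidden subgraphs on a vertex set -/

/-- The graph `G` has no edge inside the vertex set `S`. -/
def EdgeFreeOn (G : SimpleGraph V) (S : Finset V) : Prop :=
  ∀ ⦃x⦄, x ∈ S → ∀ ⦃y⦄, y ∈ S → ¬ G.Adj x y

/-- The graph `G` has no triangle inside the vertex set `S`. -/
def TriangleFreeOn (G : SimpleGraph V) (S : Finset V) : Prop :=
  ∀ ⦃x⦄, x ∈ S → ∀ ⦃y⦄, y ∈ S → ∀ ⦃z⦄, z ∈ S → G.Adj x y → G.Adj y z → ¬ G.Adj x z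

/-- The vertices `x, y, z, w` span a `K₄` in `G`. -/
structure IsK4 (G : SimpleGraph V) (x y z w : V) : Prop where
  xy : G.Adj x y
  xz : G.Adj x z
  xw : G.Adj x w
  yz : G.Adj y z
  yw : G.Adj y w
  zw : G.Adj z w

/-- The graph `G` has no copy of `twoJoinedK4` inside the vertex set `S`. -/
def TwoJoinedFreeOn (G : SimpleGraph V) (S : Finset V) : Prop :=
  ∀ ⦃x y z w v⦄, x ∈ S → y ∈ S → z ∈ S → w ∈ S → v ∈ S → IsK4 G x y z w →
    v ≠ z → v ≠ w → G.Adj v x → ¬ G.Adj v y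

variable {G R B : SimpleGraph V} {S T : Finset V}

lemma EdgeFreeOn.mono (h : EdgeFreeOn G S) (hT : T ⊆ S) : EdgeFreeOn G T :=
  fun _ hx _ hy => h (hT hx) (hT hy)

lemma TriangleFreeOn.mono (h : TriangleFreeOn G S) (hT : T ⊆ S) : TriangleFreeOn G T :=
  fun _ hx _ hy _ hz => h (hT hx) (hT hy) (hT hz)

lemma TwoJoinedFreeOn.mono (h : TwoJoinedFreeOn G S) (hT : T ⊆ S) : TwoJoinedFreeOn G T :=
  fun _ _ _ _ _ hx hy hz hw hv => h (hT hx) (hT hy) (hT hz) (hT hw) (hT hv)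

/-- If `G` has no `twoJoinedK4`, a vertex off a `K₄` of `G` is adjacent to at most one of its
vertices. -/
lemma TwoJoinedFreeOn.adj_unique (h : TwoJoinedFreeOn G S) {x y z w v p q : V}
    (hK : IsK4 G x y z w) (hx : x ∈ S) (hy : y ∈ S) (hz : z ∈ S) (hw : w ∈ S) (hv : v ∈ S)
    (hvx : v ≠ x) (hvy : v ≠ y) (hvz : v ≠ z) (hvw : v ≠ w)
    (hp : p = x ∨ p = y ∨ p = z ∨ p = w) (hq : q = x ∨ q = y ∨ q = z ∨ q = w)
    (hvp : G.Adj v p) (hvq : G.Adj v q) : p = q := by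
  obtain ⟨xy, xz, xw, yz, yw, zw⟩ := hK
  have key1 := @h x y z w v hx hy hz hw hv ⟨xy, xz, xw, yz, yw, zw⟩ hvz hvw
  have key2 := @h x z y w v hx hz hy hw hv ⟨xz, xy, xw, yz.symm, zw, yw⟩ hvy hvw
  have key3 := @h x w y z v hx hw hy hz hv ⟨xw, xy, xz, yw.symm, zw.symm, yz⟩ hvy hvz
  have key4 := @h y z x w v hy hz hx hw hv ⟨yz, xy.symm, yw, xz.symm, zw, xw⟩ hvx hvw
  have key5 := @h y w x z v hy hw hx hz hv ⟨yw, xy.symm, yz, xw.symm, zw.symm, xz⟩ hvx hvz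
  have key6 := @h z w x y v hz hw hx hy hv ⟨zw, xz.symm, yz.symm, xw.symm, yw.symm, xy⟩ hvx hvy
  rcases hp with rfl | rfl | rfl | rfl <;> rcases hq with rfl | rfl | rfl | rfl <;>
    first | rfl | tauto

/-! ### Three small Ramsey numbers -/

/-- `R(K₃, K₃) ≤ 6`. -/
lemma card_le_five (hRB : ∀ x ∈ S, ∀ y ∈ S, x ≠ y → R.Adj x y ∨ B.Adj x y)
    (hR : TriangleFreeOn R S) (hB : TriangleFreeOn B S) : S.card ≤ 5 := by
  classical
  by_contra! hS
  obtain ⟨v, hv⟩ : S.Nonempty := Finset.card_pos.1 (by omega)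
  have key : ∀ {R B : SimpleGraph V}, (∀ x ∈ S, ∀ y ∈ S, x ≠ y → R.Adj x y ∨ B.Adj x y) →
      TriangleFreeOn R S → TriangleFreeOn B S → ((S.erase v).filter (R.Adj v)).card ≤ 2 := by
    intro R B hRB hR hB
    by_contra! h
    obtain ⟨a, b, c, ha, hb, hc, hab, hac, hbc⟩ := Finset.two_lt_card_iff.1 h
    simp only [Finset.mem_filter, Finset.mem_erase] at ha hb hc
    have hab' := (hRB a ha.1.2 b hb.1.2 hab).resolve_left
      fun h => hR hv ha.1.2 hb.1.2 ha.2 h hb.2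
    have hac' := (hRB a ha.1.2 c hc.1.2 hac).resolve_left
      fun h => hR hv ha.1.2 hc.1.2 ha.2 h hc.2
    have hbc' := (hRB b hb.1.2 c hc.1.2 hbc).resolve_left
      fun h => hR hv hb.1.2 hc.1.2 hb.2 h hc.2
    exact hB ha.1.2 hb.1.2 hc.1.2 hab' hbc' hac'
  have h1 := key hRB hR hB
  have h2 := key (fun x hx y hy hxy => (hRB x hx y hy hxy).symm) hB hR
  have h3 : S.erase v ⊆ (S.erase v).filter (R.Adj v) ∪ (S.erase v).filter (B.Adj v) := by
    intro x hx
    have := Finset.mem_erase.1 hx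
    rcases hRB v hv x this.2 this.1.symm with h | h <;> simp_all
  have h4 := (Finset.card_le_card h3).trans (Finset.card_union_le _ _)
  rw [Finset.card_erase_of_mem hv] at h4
  omega

/-- In a graph on nine vertices some vertex does not have degree exactly three. -/
lemma exists_degree_ne_three [DecidableEq V] [DecidableRel R.Adj] (hS : S.card = 9) :
    ∃ v ∈ S, (S.filter (R.Adj v)).card ≠ 3 := by
  by_contra! h
  have hsum := (R.induce (S : Set V)).sum_degrees_eq_twice_card_edges
  have hdeg : ∀ v : (S : Set V), (R.induce (S : Set V)).degree v = 3 := by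
    intro v
    rw [← h v v.2, ← SimpleGraph.card_neighborFinset_eq_degree]
    refine Finset.card_bij (fun x _ => (x : V)) ?_ ?_ ?_
    · intro x hx
      simpa using hx
    · intro x _ y _ hxy
      exact Subtype.ext hxy
    · intro y hy
      rw [Finset.mem_filter] at hy
      exact ⟨⟨y, hy.1⟩, by simpa using hy.2, rfl⟩
  simp only [hdeg, Finset.sum_const, Finset.card_univ, smul_eq_mul] at hsum
  have : Fintype.card (S : Set V) = 9 := by simpa using hS
  omega

/-- `R(K₃, twoJoinedK4) ≤ 9`, for a vertex set of size exactly nine. -/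
lemma card_ne_nine (hRB : ∀ x ∈ S, ∀ y ∈ S, x ≠ y → R.Adj x y ∨ B.Adj x y)
    (hR : TriangleFreeOn R S) (hB : TwoJoinedFreeOn B S) : S.card ≠ 9 := by
  classical
  intro h9
  -- Red neighbourhoods are blue cliques. If one had four vertices, each of the remaining four
  -- vertices would send at least three red edges to it, and these four would form a blue `K₄`
  -- all of whose vertices are blue neighbours of `v`.
  have hle : ∀ v ∈ S, (S.filter (R.Adj v)).card ≤ 3 := by
    intro v hv
    by_contra! h
    obtain ⟨Q, hQ, hQ4⟩ := Finset.exists_subset_card_eq (show 4 ≤ _ from h)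
    obtain ⟨a, ha, b, hb, c, hc, d, hd, hab, hac, had, hbc, hbd, hcd⟩ :=
      Finset.three_lt_card.1 (show 3 < Q.card by omega)
    have hQS : ∀ q ∈ Q, q ∈ S ∧ R.Adj v q := fun q hq => Finset.mem_filter.1 (hQ hq)
    have hQB : ∀ p ∈ Q, ∀ q ∈ Q, p ≠ q → B.Adj p q := fun p hp q hq hpq =>
      (hRB p (hQS p hp).1 q (hQS q hq).1 hpq).resolve_left
        fun h => hR hv (hQS p hp).1 (hQS q hq).1 (hQS p hp).2 h (hQS q hq).2
    have hK : IsK4 B a b c d := ⟨hQB a ha b hb hab, hQB a ha c hc hac, hQB a ha d hd had,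
      hQB b hb c hc hbc, hQB b hb d hd hbd, hQB c hc d hd hcd⟩
    have hT : 4 ≤ ((S.erase v) \ Q).card := by
      have := Finset.le_card_sdiff Q (S.erase v)
      rw [Finset.card_erase_of_mem hv] at this
      omega
    obtain ⟨t₁, ht₁, t₂, ht₂, t₃, ht₃, t₄, ht₄, h12, h13, h14, h23, h24, h34⟩ :=
      Finset.three_lt_card.1 (show 3 < ((S.erase v) \ Q).card by omega)
    have hTS : ∀ t ∈ (S.erase v) \ Q, t ∈ S ∧ t ≠ v ∧ t ∉ Q := by
      intro t ht
      simp only [Finset.mem_sdiff, Finset.mem_erase] at ht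
      exact ⟨ht.1.2, ht.1.1, ht.2⟩
    have hred : ∀ t ∈ (S.erase v) \ Q, ∃ p, ∀ q ∈ Q,
        q = a ∨ q = b ∨ q = c ∨ q = d → q ≠ p → R.Adj t q := by
      intro t ht
      obtain ⟨htS, -, htQ⟩ := hTS t ht
      have hne : ∀ q ∈ Q, t ≠ q := fun q hq h => htQ (h ▸ hq)
      by_cases hex : ∃ p, (p = a ∨ p = b ∨ p = c ∨ p = d) ∧ B.Adj t p
      · obtain ⟨p, hp, htp⟩ := hex
        refine ⟨p, fun q hq hq' hqp => ?_⟩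
        refine (hRB t htS q (hQS q hq).1 (hne q hq)).resolve_right fun h => hqp ?_
        exact hB.adj_unique hK (hQS a ha).1 (hQS b hb).1 (hQS c hc).1 (hQS d hd).1 htS
          (hne a ha) (hne b hb) (hne c hc) (hne d hd) hq' hp h htp
      · push Not at hex
        exact ⟨a, fun q hq hq' _ =>
          (hRB t htS q (hQS q hq).1 (hne q hq)).resolve_right (hex q hq')⟩
    have hTB : ∀ t ∈ (S.erase v) \ Q, ∀ u ∈ (S.erase v) \ Q, t ≠ u → B.Adj t u := by
      intro t ht u hu htu
      refine (hRB t (hTS t ht).1 u (hTS u hu).1 htu).resolve_left fun h => ?_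
      obtain ⟨p, hp⟩ := hred t ht
      obtain ⟨q, hq⟩ := hred u hu
      have : ∃ s ∈ Q, (s = a ∨ s = b ∨ s = c ∨ s = d) ∧ s ≠ p ∧ s ≠ q := by grind
      obtain ⟨s, hs, hs', hsp, hsq⟩ := this
      exact hR (hTS t ht).1 (hTS u hu).1 (hQS s hs).1 h (hq s hs hs' hsq) (hp s hs hs' hsp)
    have hvB : ∀ t ∈ (S.erase v) \ Q, B.Adj v t := by
      intro t ht
      refine (hRB v hv t (hTS t ht).1 (hTS t ht).2.1.symm).resolve_left fun h => ?_
      obtain ⟨p, hp⟩ := hred t ht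
      have : ∃ s ∈ Q, (s = a ∨ s = b ∨ s = c ∨ s = d) ∧ s ≠ p := by grind
      obtain ⟨s, hs, hs', hsp⟩ := this
      exact hR hv (hTS t ht).1 (hQS s hs).1 h (hp s hs hs' hsp) (hQS s hs).2
    exact hB (hTS _ ht₁).1 (hTS _ ht₂).1 (hTS _ ht₃).1 (hTS _ ht₄).1 hv
      ⟨hTB _ ht₁ _ ht₂ h12, hTB _ ht₁ _ ht₃ h13, hTB _ ht₁ _ ht₄ h14, hTB _ ht₂ _ ht₃ h23,
        hTB _ ht₂ _ ht₄ h24, hTB _ ht₃ _ ht₄ h34⟩ (hTS _ ht₃).2.1.symm (hTS _ ht₄).2.1.symm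
      (hvB _ ht₁) (hvB _ ht₂)
  obtain ⟨v, hv, hne⟩ := exists_degree_ne_three (R := R) h9
  have hle' := hle v hv
  -- The at least six other vertices are blue neighbours of `v`.
  set M := (S.erase v).filter (fun u => ¬ R.Adj v u) with hM
  have hMcard : (S.filter (R.Adj v)).card + M.card = 8 := by
    have h1 := Finset.card_filter_add_card_filter_not (s := S.erase v) (R.Adj v)
    have h2 : (S.erase v).filter (R.Adj v) = S.filter (R.Adj v) := by
      ext x
      simp only [Finset.mem_filter, Finset.mem_erase]
      exact ⟨fun h => ⟨h.1.2, h.2⟩, fun h => ⟨⟨h.2.ne', h.1⟩, h.2⟩⟩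
    rw [Finset.card_erase_of_mem hv, h2, h9] at h1
    exact h1
  have hMS : ∀ u ∈ M, u ∈ S ∧ u ≠ v ∧ B.Adj v u := by
    intro u hu
    simp only [hM, Finset.mem_filter, Finset.mem_erase] at hu
    exact ⟨hu.1.2, hu.1.1, (hRB v hv u hu.1.2 hu.1.1.symm).resolve_left hu.2⟩
  have hMsub : M ⊆ S := fun u hu => (hMS u hu).1
  have htri : ¬ TriangleFreeOn B M := by
    intro h
    have := card_le_five (fun x hx y hy => hRB x (hMsub hx) y (hMsub hy)) (hR.mono hMsub) h
    omega
  simp only [TriangleFreeOn, not_forall, not_not] at htri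
  obtain ⟨x, hx, y, hy, z, hz, xy, yz, xz⟩ := htri
  have hK : IsK4 B v x y z := ⟨(hMS x hx).2.2, (hMS y hy).2.2, (hMS z hz).2.2, xy, xz, yz⟩
  set W := M \ {x, y, z} with hW
  have hWc : M.card ≤ W.card + 3 := by
    have h1 := Finset.le_card_sdiff {x, y, z} M
    rw [← hW] at h1
    have h2 := Finset.card_le_three (a := x) (b := y) (c := z)
    omega
  have hWM : ∀ w ∈ W, w ∈ M ∧ w ≠ x ∧ w ≠ y ∧ w ≠ z := by
    intro w hw
    simpa [hW] using hw
  have hWR : ∀ w ∈ W, ∀ p, p = x ∨ p = y ∨ p = z → R.Adj w p := by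
    intro w hw p hp
    obtain ⟨hwM, hwx, hwy, hwz⟩ := hWM w hw
    have hpM : p ∈ M := by rcases hp with rfl | rfl | rfl <;> assumption
    have hwp : w ≠ p := by rcases hp with rfl | rfl | rfl <;> assumption
    refine (hRB w (hMS w hwM).1 p (hMS p hpM).1 hwp).resolve_right fun h => ?_
    have := hB.adj_unique hK hv (hMS x hx).1 (hMS y hy).1 (hMS z hz).1 (hMS w hwM).1
      (hMS w hwM).2.1 hwx hwy hwz (Or.inr hp) (Or.inl rfl) h (hMS w hwM).2.2.symm
    exact (hMS p hpM).2.1 this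
  have hWB : ∀ w ∈ W, ∀ u ∈ W, w ≠ u → B.Adj w u := by
    intro w hw u hu hwu
    refine (hRB w (hMS w (hWM w hw).1).1 u (hMS u (hWM u hu).1).1 hwu).resolve_left fun h => ?_
    exact hR (hMS w (hWM w hw).1).1 (hMS u (hWM u hu).1).1 (hMS x hx).1 h
      (hWR u hu x (Or.inl rfl)) (hWR w hw x (Or.inl rfl))
  have hW' : ∀ w ∈ W, w ∈ S ∧ w ≠ v ∧ B.Adj v w := fun w hw => hMS w (hWM w hw).1
  have hW3 : W.card ≤ 3 := by
    by_contra! h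
    obtain ⟨t₁, ht₁, t₂, ht₂, t₃, ht₃, t₄, ht₄, h12, h13, h14, h23, h24, h34⟩ :=
      Finset.three_lt_card.1 h
    exact hB (hW' _ ht₁).1 (hW' _ ht₂).1 (hW' _ ht₃).1 (hW' _ ht₄).1 hv
      ⟨hWB _ ht₁ _ ht₂ h12, hWB _ ht₁ _ ht₃ h13, hWB _ ht₁ _ ht₄ h14, hWB _ ht₂ _ ht₃ h23,
        hWB _ ht₂ _ ht₄ h24, hWB _ ht₃ _ ht₄ h34⟩ (hW' _ ht₃).2.1.symm (hW' _ ht₄).2.1.symm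
      (hW' _ ht₁).2.2 (hW' _ ht₂).2.2
  obtain ⟨w₁, w₂, w₃, hw₁, hw₂, hw₃, h12, h13, h23⟩ :=
    Finset.two_lt_card_iff.1 (show 2 < W.card by omega)
  have hK' : IsK4 B v w₁ w₂ w₃ := ⟨(hW' _ hw₁).2.2, (hW' _ hw₂).2.2, (hW' _ hw₃).2.2,
    hWB _ hw₁ _ hw₂ h12, hWB _ hw₁ _ hw₃ h13, hWB _ hw₂ _ hw₃ h23⟩
  -- A red neighbour of `v` sends a red edge to each of the two blue triangles, which are joined
  -- in red.
  obtain ⟨p, hp⟩ : (S.filter (R.Adj v)).Nonempty := Finset.card_pos.1 (by omega)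
  rw [Finset.mem_filter] at hp
  have hpM : p ∉ M := fun h => (Finset.mem_filter.1 h).2 hp.2
  have hpne : ∀ m ∈ M, p ≠ m := fun m hm h => hpM (h ▸ hm)
  have hx' : ∃ q, (q = x ∨ q = y ∨ q = z) ∧ R.Adj p q := by
    by_contra! h
    have h1 := (hRB p hp.1 x (hMS x hx).1 (hpne x hx)).resolve_left (h x (by simp))
    have h2 := (hRB p hp.1 y (hMS y hy).1 (hpne y hy)).resolve_left (h y (by simp))
    exact xy.ne (hB.adj_unique hK hv (hMS x hx).1 (hMS y hy).1 (hMS z hz).1 hp.1 hp.2.ne'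
      (hpne x hx) (hpne y hy) (hpne z hz) (by simp) (by simp) h1 h2)
  have hw' : ∃ q ∈ W, R.Adj p q := by
    by_contra! h
    have hpW : ∀ m ∈ W, p ≠ m := fun m hm => hpne m (hWM m hm).1
    have h1 := (hRB p hp.1 w₁ (hW' _ hw₁).1 (hpW _ hw₁)).resolve_left (h _ hw₁)
    have h2 := (hRB p hp.1 w₂ (hW' _ hw₂).1 (hpW _ hw₂)).resolve_left (h _ hw₂)
    exact h12 (hB.adj_unique hK' hv (hW' _ hw₁).1 (hW' _ hw₂).1 (hW' _ hw₃).1 hp.1 hp.2.ne'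
      (hpW _ hw₁) (hpW _ hw₂) (hpW _ hw₃) (by simp) (by simp) h1 h2)
  obtain ⟨q, hq, hpq⟩ := hx'
  obtain ⟨w, hw, hpw⟩ := hw'
  have hqS : q ∈ S := by
    rcases hq with rfl | rfl | rfl
    exacts [(hMS _ hx).1, (hMS _ hy).1, (hMS _ hz).1]
  exact hR hp.1 (hW' w hw).1 hqS hpw (hWR w hw q hq) hpq

/-- `R(K₃, twoJoinedK4) ≤ 9`. -/
lemma card_le_eight (hRB : ∀ x ∈ S, ∀ y ∈ S, x ≠ y → R.Adj x y ∨ B.Adj x y)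
    (hR : TriangleFreeOn R S) (hB : TwoJoinedFreeOn B S) : S.card ≤ 8 := by
  by_contra! hcard
  obtain ⟨T, hT, h9⟩ := Finset.exists_subset_card_eq (show 9 ≤ S.card by omega)
  exact card_ne_nine (fun x hx y hy => hRB x (hT hx) y (hT hy)) (hR.mono hT) (hB.mono hT) h9

/-- In a two-coloring of more than ten vertices without a monochromatic `twoJoinedK4`, every vertex
is incident to at most eight red edges. -/
lemma card_filter_adj_le_eight [DecidableEq V] [DecidableRel R.Adj]
    (hRB : ∀ x ∈ S, ∀ y ∈ S, x ≠ y → R.Adj x y ∨ B.Adj x y)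
    (hR : TwoJoinedFreeOn R S) (hB : TwoJoinedFreeOn B S) (hS : 10 < S.card)
    {v : V} (hv : v ∈ S) : (S.filter (R.Adj v)).card ≤ 8 := by
  by_contra! h9
  set N := S.filter (R.Adj v) with hN
  have hNS : ∀ u ∈ N, u ∈ S ∧ R.Adj v u := fun u hu => Finset.mem_filter.1 hu
  have hNsub : N ⊆ S := Finset.filter_subset _ _
  -- Each red triangle in the red neighbourhood `N` of `v` is joined to the rest of `N` in blue.
  have hout : ∀ x ∈ N, ∀ y ∈ N, ∀ z ∈ N, R.Adj x y → R.Adj y z → R.Adj x z →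
      ∀ m ∈ N, m ≠ x → m ≠ y → m ≠ z → ∀ p, p = x ∨ p = y ∨ p = z → B.Adj m p := by
    intro x hx y hy z hz xy yz xz m hm hmx hmy hmz p hp
    have hpN : p ∈ N := by rcases hp with rfl | rfl | rfl <;> assumption
    have hmp : m ≠ p := by rcases hp with rfl | rfl | rfl <;> assumption
    refine (hRB m (hNsub hm) p (hNsub hpN) hmp).resolve_left fun h => ?_
    exact (hNS p hpN).2.ne (hR.adj_unique ⟨(hNS x hx).2, (hNS y hy).2, (hNS z hz).2, xy, xz, yz⟩
      hv (hNsub hx) (hNsub hy) (hNsub hz) (hNsub hm) (hNS m hm).2.ne' hmx hmy hmz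
      (Or.inr hp) (Or.inl rfl) h (hNS m hm).2.symm).symm
  have htri : ¬ TriangleFreeOn R N := fun h => by
    have := card_le_eight (fun x hx y hy => hRB x (hNsub hx) y (hNsub hy)) h (hB.mono hNsub)
    omega
  simp only [TriangleFreeOn, not_forall, not_not] at htri
  obtain ⟨x, hx, y, hy, z, hz, xy, yz, xz⟩ := htri
  set M := N \ {x, y, z} with hM
  have hMc : N.card ≤ M.card + 3 := by
    have h1 := Finset.le_card_sdiff {x, y, z} N
    rw [← hM] at h1
    have h2 := Finset.card_le_three (a := x) (b := y) (c := z)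
    omega
  have hMN : ∀ m ∈ M, m ∈ N ∧ m ≠ x ∧ m ≠ y ∧ m ≠ z := fun m hm => by simpa [hM] using hm
  have hMsub : M ⊆ N := fun m hm => (hMN m hm).1
  have hMx : ∀ m ∈ M, ∀ p, p = x ∨ p = y ∨ p = z → B.Adj m p := fun m hm =>
    hout x hx y hy z hz xy yz xz m (hMN m hm).1 (hMN m hm).2.1 (hMN m hm).2.2.1 (hMN m hm).2.2.2
  have hMB : TriangleFreeOn B M := by
    intro a ha b hb c hc hab hbc hac
    have hn : ∀ m ∈ M, m ∈ S := fun m hm => hNsub (hMsub hm)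
    exact hB (hn a ha) (hn b hb) (hn c hc) (hNsub hx) (hNsub hy)
      ⟨hab, hac, hMx a ha x (by simp), hbc, hMx b hb x (by simp), hMx c hc x (by simp)⟩
      (hMN c hc).2.2.1.symm xy.ne' (hMx a ha y (by simp)).symm (hMx b hb y (by simp)).symm
  have htri' : ¬ TriangleFreeOn R M := fun h => by
    have := card_le_five (fun x hx y hy => hRB x (hNsub (hMsub hx)) y (hNsub (hMsub hy))) h hMB
    omega
  simp only [TriangleFreeOn, not_forall, not_not] at htri'
  obtain ⟨a, ha, b, hb, c, hc, ab, bc, ac⟩ := htri'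
  set L := M \ {a, b, c} with hL
  have hLc : M.card ≤ L.card + 3 := by
    have h1 := Finset.le_card_sdiff {a, b, c} M
    rw [← hL] at h1
    have h2 := Finset.card_le_three (a := a) (b := b) (c := c)
    omega
  have hLM : ∀ m ∈ L, m ∈ M ∧ m ≠ a ∧ m ≠ b ∧ m ≠ c := fun m hm => by simpa [hL] using hm
  have hLS : ∀ m ∈ L, m ∈ S ∧ R.Adj v m := fun m hm => hNS m (hMsub (hLM m hm).1)
  have hLa : ∀ m ∈ L, ∀ p, p = a ∨ p = b ∨ p = c → B.Adj m p := fun m hm =>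
    hout a (hMsub ha) b (hMsub hb) c (hMsub hc) ab bc ac m (hMsub (hLM m hm).1)
      (hLM m hm).2.1 (hLM m hm).2.2.1 (hLM m hm).2.2.2
  have hLR : ∀ m ∈ L, ∀ l ∈ L, m ≠ l → R.Adj m l := fun m hm l hl hml =>
    (hRB m (hLS m hm).1 l (hLS l hl).1 hml).resolve_right fun h =>
      hMB (hLM m hm).1 (hLM l hl).1 ha h (hLa l hl a (by simp)) (hLa m hm a (by simp))
  have hL3 : L.card ≤ 3 := by
    by_contra! h
    obtain ⟨t₁, ht₁, t₂, ht₂, t₃, ht₃, t₄, ht₄, h12, h13, h14, h23, h24, h34⟩ :=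
      Finset.three_lt_card.1 h
    exact hR (hLS _ ht₁).1 (hLS _ ht₂).1 (hLS _ ht₃).1 (hLS _ ht₄).1 hv
      ⟨hLR _ ht₁ _ ht₂ h12, hLR _ ht₁ _ ht₃ h13, hLR _ ht₁ _ ht₄ h14, hLR _ ht₂ _ ht₃ h23,
        hLR _ ht₂ _ ht₄ h24, hLR _ ht₃ _ ht₄ h34⟩ (hLS _ ht₃).2.ne (hLS _ ht₄).2.ne
      (hLS _ ht₁).2 (hLS _ ht₂).2
  obtain ⟨l, m, n, hl, hm, hn, lm, ln, mn⟩ :=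
    Finset.two_lt_card_iff.1 (show 2 < L.card by omega)
  -- So `N` consists of three red triangles that are joined in blue, and some vertex `p` lies
  -- outside `N` and is blue to all but at most one vertex of each of them.
  obtain ⟨p, hp, hpN⟩ : ∃ p ∈ S.erase v, p ∉ N := by
    refine Finset.exists_mem_notMem_of_card_lt_card ?_
    rw [Finset.card_erase_of_mem hv]
    omega
  obtain ⟨hpv, hpS⟩ := Finset.mem_erase.1 hp
  have hpne : ∀ q ∈ N, p ≠ q := fun q hq h => hpN (h ▸ hq)
  have hpB : ∀ q₁ ∈ N, ∀ q₂ ∈ N, ∀ q₃ ∈ N, R.Adj q₁ q₂ → R.Adj q₂ q₃ → R.Adj q₁ q₃ →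
      (B.Adj p q₁ ∨ B.Adj p q₂) ∧ (B.Adj p q₁ ∨ B.Adj p q₃) ∧ (B.Adj p q₂ ∨ B.Adj p q₃) := by
    intro q₁ h₁ q₂ h₂ q₃ h₃ h12 h23 h13
    have hK : IsK4 R v q₁ q₂ q₃ := ⟨(hNS _ h₁).2, (hNS _ h₂).2, (hNS _ h₃).2, h12, h13, h23⟩
    have key : ∀ q ∈ N, ∀ q' ∈ N, q ≠ q' → (q = q₁ ∨ q = q₂ ∨ q = q₃) →
        (q' = q₁ ∨ q' = q₂ ∨ q' = q₃) → B.Adj p q ∨ B.Adj p q' := by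
      intro q hq q' hq' hne hq1 hq1'
      by_contra! h
      have hr := (hRB p hpS q (hNsub hq) (hpne q hq)).resolve_right h.1
      have hr' := (hRB p hpS q' (hNsub hq') (hpne q' hq')).resolve_right h.2
      exact hne (hR.adj_unique hK hv (hNsub h₁) (hNsub h₂) (hNsub h₃) hpS hpv (hpne _ h₁)
        (hpne _ h₂) (hpne _ h₃) (Or.inr hq1) (Or.inr hq1') hr hr')
    exact ⟨key _ h₁ _ h₂ h12.ne (by simp) (by simp), key _ h₁ _ h₃ h13.ne (by simp) (by simp),
      key _ h₂ _ h₃ h23.ne (by simp) (by simp)⟩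
  obtain ⟨q, q', hq, hq', hqq', hpq, hpq'⟩ : ∃ q q', (q = x ∨ q = y ∨ q = z) ∧
      (q' = x ∨ q' = y ∨ q' = z) ∧ q ≠ q' ∧ B.Adj p q ∧ B.Adj p q' := by
    have := hpB x hx y hy z hz xy yz xz
    have h1 := xy.ne
    have h2 := xz.ne
    have h3 := yz.ne
    by_cases hpx : B.Adj p x
    · by_cases hpy : B.Adj p y
      · exact ⟨x, y, by simp, by simp, h1, hpx, hpy⟩
      · exact ⟨x, z, by simp, by simp, h2, hpx, by tauto⟩
    · exact ⟨y, z, by simp, by simp, h3, by tauto, by tauto⟩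
  obtain ⟨a', ha', hpa⟩ : ∃ a', (a' = a ∨ a' = b ∨ a' = c) ∧ B.Adj p a' := by
    rcases (hpB a (hMsub ha) b (hMsub hb) c (hMsub hc) ab bc ac).1 with h | h
    exacts [⟨a, by simp, h⟩, ⟨b, by simp, h⟩]
  have hLN : ∀ m ∈ L, m ∈ N := fun m hm => hMsub (hLM m hm).1
  obtain ⟨l', hl', hpl⟩ : ∃ l' ∈ L, B.Adj p l' := by
    rcases (hpB l (hLN l hl) m (hLN m hm) n (hLN n hn) (hLR l hl m hm lm) (hLR m hm n hn mn)
      (hLR l hl n hn ln)).1 with h | h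
    exacts [⟨l, hl, h⟩, ⟨m, hm, h⟩]
  have ha'M : a' ∈ M := by rcases ha' with rfl | rfl | rfl <;> assumption
  have hqN : q ∈ N := by rcases hq with rfl | rfl | rfl <;> assumption
  have hqN' : q' ∈ N := by rcases hq' with rfl | rfl | rfl <;> assumption
  exact hB (hNsub (hMsub ha'M)) (hLS l' hl').1 hpS (hNsub hqN) (hNsub hqN')
    ⟨(hLa l' hl' a' ha').symm, hpa.symm, hMx a' ha'M q hq, hpl.symm, hMx l' (hLM l' hl').1 q hq,
      hpq⟩ (hpne q' hqN').symm hqq'.symm (hMx a' ha'M q' hq').symm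
    (hMx l' (hLM l' hl').1 q' hq').symm

/-- `R(twoJoinedK4, twoJoinedK4) ≤ 18`. -/
lemma card_le_seventeen (hRB : ∀ x ∈ S, ∀ y ∈ S, x ≠ y → R.Adj x y ∨ B.Adj x y)
    (hR : TwoJoinedFreeOn R S) (hB : TwoJoinedFreeOn B S) : S.card ≤ 17 := by
  classical
  by_contra! hS
  obtain ⟨v, hv⟩ : S.Nonempty := Finset.card_pos.1 (by omega)
  have h1 := card_filter_adj_le_eight hRB hR hB (by omega) hv
  have h2 := card_filter_adj_le_eight (fun x hx y hy h => (hRB x hx y hy h).symm) hB hR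
    (by omega) hv
  have h3 : S.erase v ⊆ S.filter (R.Adj v) ∪ S.filter (B.Adj v) := by
    intro x hx
    have := Finset.mem_erase.1 hx
    rcases hRB v hv x this.2 this.1.symm with h | h <;> simp_all
  have h4 := (Finset.card_le_card h3).trans (Finset.card_union_le _ _)
  rw [Finset.card_erase_of_mem hv] at h4
  omega

/-! ### Gallai partitions -/

section Partition

variable {K : Type*} {c : TopEdgeLabeling V K}

lemma exists_adj (c : TopEdgeLabeling V K) {x y : V} (h : x ≠ y) :
    ∃ i, (c.labelGraph i).Adj x y :=
  ⟨c.get x y h, (TopEdgeLabeling.labelGraph_adj x y).2 ⟨h, rfl⟩⟩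

lemma color_unique {i j : K} {x y : V} (hi : (c.labelGraph i).Adj x y)
    (hj : (c.labelGraph j).Adj x y) : i = j := by
  rw [TopEdgeLabeling.labelGraph_adj] at hi hj
  obtain ⟨_, hi⟩ := hi
  obtain ⟨_, hj⟩ := hj
  exact hi.symm.trans hj

lemma _root_.IsGallaiColoring.color_eq (hc : IsGallaiColoring c) {i j k : K} {x y z : V}
    (hi : (c.labelGraph i).Adj x y) (hj : (c.labelGraph j).Adj y z)
    (hk : (c.labelGraph k).Adj x z) : i = j ∨ j = k ∨ i = k := by
  rw [TopEdgeLabeling.labelGraph_adj] at hi hj hk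
  obtain ⟨hxy, rfl⟩ := hi
  obtain ⟨hyz, rfl⟩ := hj
  obtain ⟨hxz, rfl⟩ := hk
  have := hc x y z hxy hyz hxz
  tauto

/-- The vertices `x` and `y` are equal or lie in the same connected component of the subgraph of `G`
induced on `S`. -/
def Linked (G : SimpleGraph V) (S : Finset V) : V → V → Prop :=
  Relation.EqvGen fun x y => x ∈ S ∧ y ∈ S ∧ G.Adj x y

/-- The subgraph of `G` induced on `S` is connected or empty. -/
def ConnectedOn (G : SimpleGraph V) (S : Finset V) : Prop :=
  ∀ ⦃x⦄, x ∈ S → ∀ ⦃y⦄, y ∈ S → Linked G S x y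

lemma Linked.invariant {P : V → Prop} {x y : V} (h : Linked G S x y)
    (hP : ∀ x ∈ S, ∀ y ∈ S, G.Adj x y → (P x ↔ P y)) : P x ↔ P y := by
  induction h with
  | rel x y h => exact hP x h.1 y h.2.1 h.2.2
  | refl => exact Iff.rfl
  | symm _ _ _ ih => exact ih.symm
  | trans _ _ _ _ _ ih₁ ih₂ => exact ih₁.trans ih₂

lemma Linked.of_adj {x y : V} (hx : x ∈ S) (hy : y ∈ S) (h : G.Adj x y) : Linked G S x y :=
  .rel _ _ ⟨hx, hy, h⟩

lemma Linked.symm {x y : V} (h : Linked G S x y) : Linked G S y x := Relation.EqvGen.symm _ _ h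

lemma Linked.trans {x y z : V} (h : Linked G S x y) (h' : Linked G S y z) : Linked G S x z :=
  Relation.EqvGen.trans _ _ _ h h'

lemma Linked.mem_iff {x y : V} (h : Linked G S x y) : x ∈ S ↔ y ∈ S :=
  h.invariant fun _ hx _ hy _ => iff_of_true hx hy

/-- A vertex outside a component of one color class sees that component in a single color. -/
lemma Linked.adj_iff (hc : IsGallaiColoring c) {i : K} {x x' : V}
    (h : Linked (c.labelGraph i) S x x') (j : K) :
    ∀ y ∈ S, ¬ Linked (c.labelGraph i) S x y →
      ((c.labelGraph j).Adj x y ↔ (c.labelGraph j).Adj x' y) := by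
  induction h with
  | rel x x' h =>
    intro y hy hxy
    obtain ⟨hx, hx', hxx'⟩ := h
    have hlink : Linked (c.labelGraph i) S x x' := .of_adj hx hx' hxx'
    have hne : x ≠ y := by rintro rfl; exact hxy (.refl _)
    have hne' : x' ≠ y := by rintro rfl; exact hxy hlink
    obtain ⟨k, hk⟩ := exists_adj c hne
    obtain ⟨l, hl⟩ := exists_adj c hne'
    have hik : i ≠ k := by
      rintro rfl
      exact hxy (.of_adj hx hy hk)
    have hil : i ≠ l := by
      rintro rfl
      exact hxy (hlink.trans (.of_adj hx' hy hl))
    have hkl : l = k := by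
      rcases hc.color_eq hxx' hl hk with h | h | h
      exacts [(hil h).elim, h, (hik h).elim]
    subst hkl
    exact ⟨fun h => color_unique h hk ▸ hl, fun h => color_unique h hl ▸ hk⟩
  | refl => exact fun _ _ _ => Iff.rfl
  | symm x x' h ih =>
    intro y hy hxy
    exact (ih y hy fun h' => hxy (Linked.trans (Linked.symm h) h')).symm
  | trans x x' x'' h h' ih ih' =>
    intro y hy hxy
    exact (ih y hy hxy).trans (ih' y hy fun h'' => hxy (Linked.trans h h''))

/-- If `G` is connected on `S`, the vertex `v ∈ S` has a neighbour in each component of the rest. -/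
lemma ConnectedOn.exists_adj_linked [DecidableEq V] (h : ConnectedOn G S) {v w : V} (hv : v ∈ S)
    (hw : w ∈ S.erase v) : ∃ u ∈ S.erase v, Linked G (S.erase v) w u ∧ G.Adj v u := by
  by_contra! hno
  have hvw := h (Finset.mem_of_mem_erase hw) hv
  have hinv := hvw.invariant (P := Linked G (S.erase v) w) ?_
  · exact Finset.notMem_erase v S ((hinv.1 (.refl _)).mem_iff.1 hw)
  · have key : ∀ x ∈ S, ∀ y ∈ S, G.Adj x y → Linked G (S.erase v) w x →
        Linked G (S.erase v) w y := by
      intro x hx y hy hxy hwx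
      have hx' := hwx.mem_iff.1 hw
      by_cases hyv : y = v
      · subst hyv
        exact (hno x hx' hwx hxy.symm).elim
      · exact hwx.trans (.of_adj hx' (Finset.mem_erase.2 ⟨hyv, hy⟩) hxy)
    exact fun x hx y hy hxy => ⟨key x hx y hy hxy, key y hy x hx hxy.symm⟩

lemma ConnectedOn.exists_adj [DecidableEq V] (h : ConnectedOn G S) {v : V} (hv : v ∈ S)
    (hS : 2 ≤ S.card) : ∃ u ∈ S.erase v, G.Adj v u := by
  obtain ⟨w, hw⟩ : (S.erase v).Nonempty :=
    Finset.card_pos.1 (by rw [Finset.card_erase_of_mem hv]; omega)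
  obtain ⟨u, hu, -, hvu⟩ := h.exists_adj_linked hv hw
  exact ⟨u, hu, hvu⟩

/-- If three color classes are connected on `S`, each of them stays connected when a vertex `v` is
deleted: otherwise `v` would see, in the second color, a vertex `y` that all other components of the
first color see in the second color, and likewise for the third color. -/
lemma ConnectedOn.erase [DecidableEq V] (hc : IsGallaiColoring c) {i j k : K} (hij : i ≠ j)
    (hik : i ≠ k) (hjk : j ≠ k) (hi : ConnectedOn (c.labelGraph i) S)
    (hj : ConnectedOn (c.labelGraph j) S) (hk : ConnectedOn (c.labelGraph k) S)
    (hS : 2 ≤ S.card) {v : V} (hv : v ∈ S) : ConnectedOn (c.labelGraph i) (S.erase v) := by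
  by_contra hdis
  simp only [ConnectedOn, not_forall] at hdis
  obtain ⟨a, ha, b, hb, hab⟩ := hdis
  have key : ∀ l, i ≠ l → ∀ y ∈ S.erase v, (c.labelGraph l).Adj v y → ∀ u ∈ S.erase v,
      ¬ Linked (c.labelGraph i) (S.erase v) u y → (c.labelGraph l).Adj u y := by
    intro l hil y hy hvy u hu huy
    obtain ⟨u', hu', huu', hvu'⟩ := hi.exists_adj_linked hv hu
    rw [huu'.adj_iff hc l y hy huy]
    have huy' : ¬ Linked (c.labelGraph i) (S.erase v) u' y := fun h => huy (huu'.trans h)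
    have hne : u' ≠ y := by rintro rfl; exact huy' (.refl _)
    obtain ⟨m, hm⟩ := GallaiRamsey.exists_adj c hne
    rcases hc.color_eq hvu' hm hvy with h | h | h
    · exact (huy' (.of_adj hu' hy (h ▸ hm))).elim
    · exact h ▸ hm
    · exact (hil h).elim
  obtain ⟨y, hy, hvy⟩ := hj.exists_adj hv hS
  obtain ⟨z, hz, hvz⟩ := hk.exists_adj hv hS
  by_cases hyz : Linked (c.labelGraph i) (S.erase v) y z
  · obtain ⟨u, hu, huy⟩ : ∃ u ∈ S.erase v, ¬ Linked (c.labelGraph i) (S.erase v) u y := by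
      by_contra! h
      exact hab ((h a ha).trans (h b hb).symm)
    have h1 := key j hij y hy hvy u hu huy
    have h2 := key k hik z hz hvz u hu fun h => huy (h.trans hyz.symm)
    have h3 := (hyz.adj_iff hc j u hu fun h => huy h.symm).1 h1.symm
    exact hjk (color_unique h3 h2.symm)
  · exact hjk (color_unique (key j hij y hy hvy z hz fun h => hyz h.symm).symm
      (key k hik z hz hvz y hy hyz))

/-- At most two color classes of a Gallai coloring are connected. -/
lemma not_three_connectedOn (hc : IsGallaiColoring c) {i j k : K} (hij : i ≠ j) (hik : i ≠ k)
    (hjk : j ≠ k) (hS : 2 ≤ S.card) (hi : ConnectedOn (c.labelGraph i) S)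
    (hj : ConnectedOn (c.labelGraph j) S) (hk : ConnectedOn (c.labelGraph k) S) : False := by
  classical
  induction S using Finset.strongInduction with
  | H S ih =>
    obtain ⟨v, hv⟩ : S.Nonempty := Finset.card_pos.1 (by omega)
    by_cases h2 : 2 ≤ (S.erase v).card
    · exact ih _ (Finset.erase_ssubset hv) h2 (hi.erase hc hij hik hjk hj hk hS hv)
        (hj.erase hc hij.symm hjk hik hi hk hS hv) (hk.erase hc hik.symm hjk.symm hij hi hj hS hv)
    · obtain ⟨x, hx, hvx⟩ := hi.exists_adj hv hS
      obtain ⟨y, hy, hvy⟩ := hj.exists_adj hv hS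
      obtain rfl : x = y := Finset.card_le_one.1 (by omega) x hx y hy
      exact hij (color_unique hvx hvy)

/-- The fibres of `P` form a Gallai partition of `S` for the colors `i` and `j`: there are at least
two of them, each vertex sees each fibre not containing it in a single color, and only the colors
`i` and `j` occur between fibres. -/
structure IsGallaiPartition (c : TopEdgeLabeling V K) (S : Finset V) (P : V → V) (i j : K) :
    Prop where
  nontrivial : ∃ x ∈ S, ∃ y ∈ S, P x ≠ P y
  adj_or : ∀ x ∈ S, ∀ y ∈ S, P x ≠ P y → (c.labelGraph i).Adj x y ∨ (c.labelGraph j).Adj x y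
  homogeneous : ∀ x ∈ S, ∀ x' ∈ S, ∀ y ∈ S, P x = P x' → P x ≠ P y →
    ∀ l, (c.labelGraph l).Adj x y → (c.labelGraph l).Adj x' y

/-- Gallai's theorem. The components of a disconnected color class form a partition that can be
coarsened, by induction, to the required one. -/
lemma exists_isGallaiPartition (hc : IsGallaiColoring c) (hS : 2 ≤ S.card) :
    ∃ P i j, IsGallaiPartition c S P i j := by
  classical
  induction hn : S.card using Nat.strong_induction_on generalizing S with
  | h n ih =>
    subst hn
    by_cases h2 : ∃ i j, ∀ x ∈ S, ∀ y ∈ S, x ≠ y →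
        (c.labelGraph i).Adj x y ∨ (c.labelGraph j).Adj x y
    · obtain ⟨i, j, hij⟩ := h2
      refine ⟨id, i, j, Finset.one_lt_card.1 hS, hij, ?_⟩
      rintro x - x' - y - rfl - l h
      exact h
    -- Three different colors occur, so one that occurs is disconnected.
    obtain ⟨m, hm, x₀, hx₀, y₀, hy₀, hxy₀⟩ : ∃ m, ¬ ConnectedOn (c.labelGraph m) S ∧
        ∃ x ∈ S, ∃ y ∈ S, (c.labelGraph m).Adj x y := by
      push Not at h2
      obtain ⟨x, hx, y, hy, hxy⟩ := Finset.one_lt_card.1 hS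
      obtain ⟨i, hi⟩ := exists_adj c hxy
      obtain ⟨x', hx', y', hy', hxy', hni, -⟩ := h2 i i
      obtain ⟨j, hj⟩ := exists_adj c hxy'
      obtain ⟨x'', hx'', y'', hy'', hxy'', hni', hnj'⟩ := h2 i j
      obtain ⟨k, hk⟩ := exists_adj c hxy''
      have hij : i ≠ j := by rintro rfl; exact hni hj
      have hik : i ≠ k := by rintro rfl; exact hni' hk
      have hjk : j ≠ k := by rintro rfl; exact hnj' hk
      by_contra! hcon
      have hcon' : ∀ m, (∃ x ∈ S, ∃ y ∈ S, (c.labelGraph m).Adj x y) →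
          ConnectedOn (c.labelGraph m) S := by
        rintro m ⟨x, hx, y, hy, h⟩
        by_contra hm
        exact hcon m hm x hx y hy h
      exact not_three_connectedOn hc hij hik hjk hS (hcon' i ⟨x, hx, y, hy, hi⟩)
        (hcon' j ⟨x', hx', y', hy', hj⟩) (hcon' k ⟨x'', hx'', y'', hy'', hk⟩)
    -- One vertex is chosen from each of its components.
    let s : Setoid V := Relation.EqvGen.setoid
      fun x y => x ∈ S ∧ y ∈ S ∧ (c.labelGraph m).Adj x y
    let ρ : V → V := fun x => (Quotient.mk s x).out
    have hρ : ∀ x, Linked (c.labelGraph m) S (ρ x) x := fun x =>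
      Quotient.exact (s := s) (Quotient.out_eq _)
    have hρeq : ∀ x y, ρ x = ρ y ↔ Linked (c.labelGraph m) S x y := by
      intro x y
      constructor
      · intro h
        exact (hρ x).symm.trans (h ▸ hρ y)
      · intro h
        have : Quotient.mk s x = Quotient.mk s y := Quotient.sound h
        simp only [ρ, this]
    have hρS : ∀ x ∈ S, ρ x ∈ S := fun x hx => (hρ x).mem_iff.2 hx
    have hlt : (S.image ρ).card < S.card := by
      refine Finset.card_image_le.lt_of_ne fun h => ?_
      exact hxy₀.ne (Finset.card_image_iff.1 h hx₀ hy₀ ((hρeq _ _).2 (.of_adj hx₀ hy₀ hxy₀)))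
    have hge : 2 ≤ (S.image ρ).card := by
      simp only [ConnectedOn, not_forall] at hm
      obtain ⟨x, hx, y, hy, hxy⟩ := hm
      exact Finset.one_lt_card.2 ⟨ρ x, Finset.mem_image_of_mem _ hx, ρ y,
        Finset.mem_image_of_mem _ hy, fun h => hxy ((hρeq _ _).1 h)⟩
    obtain ⟨P, i, j, hP⟩ := ih _ hlt hge rfl
    have hadj : ∀ x ∈ S, ∀ y ∈ S, P (ρ x) ≠ P (ρ y) → ∀ l,
        ((c.labelGraph l).Adj x y ↔ (c.labelGraph l).Adj (ρ x) (ρ y)) := by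
      intro x hx y hy hxy l
      have hne : ¬ Linked (c.labelGraph m) S x y := fun h => hxy (by rw [(hρeq x y).2 h])
      have h1 := (hρ x).symm.adj_iff hc l y hy hne
      have h2 := (hρ y).symm.adj_iff hc l (ρ x) (hρS x hx)
        fun h => hne ((hρ x).symm.trans h.symm)
      rw [h1, SimpleGraph.adj_comm, h2, SimpleGraph.adj_comm]
    have hmem : ∀ x ∈ S, ρ x ∈ S.image ρ := fun x hx => Finset.mem_image_of_mem _ hx
    refine ⟨P ∘ ρ, i, j, ?_, ?_, ?_⟩
    · obtain ⟨x', hx', y', hy', hxy'⟩ := hP.nontrivial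
      obtain ⟨x, hx, rfl⟩ := Finset.mem_image.1 hx'
      obtain ⟨y, hy, rfl⟩ := Finset.mem_image.1 hy'
      exact ⟨x, hx, y, hy, hxy'⟩
    · intro x hx y hy hxy
      rw [hadj x hx y hy hxy, hadj x hx y hy hxy]
      exact hP.adj_or _ (hmem x hx) _ (hmem y hy) hxy
    · intro x hx x' hx' y hy hxx' hxy l h
      have hxy' : P (ρ x') ≠ P (ρ y) := fun h => hxy (hxx'.trans h)
      rw [hadj x' hx' y hy hxy']
      rw [hadj x hx y hy hxy] at h
      exact hP.homogeneous _ (hmem x hx) _ (hmem x' hx') _ (hmem y hy) hxx' hxy l h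

end Partition

/-! ### The extremal numbers -/

/-- The factor contributed to the extremal number by `a` colors in which triangles are forbidden. -/
def triangleFactor : ℕ → ℕ
  | 0 => 1
  | 1 => 2
  | n + 2 => 5 * triangleFactor n

/-- The factor contributed to the extremal number by `r` colors in which one of the two five-vertex
graphs is forbidden. -/
def fiveVertexFactor : ℕ → ℕ
  | 0 => 1
  | 1 => 4
  | n + 2 => 17 * fiveVertexFactor n

/-- The largest number of vertices of a Gallai coloring that avoids triangles in each of `a` colors
and one of the two five-vertex graphs in each of `r` further colors. -/
def extremal (a r : ℕ) : ℕ := triangleFactor a * fiveVertexFactor r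

lemma triangleFactor_cases (a : ℕ) : ∃ x ≥ 1,
    (triangleFactor a = x ∧ triangleFactor (a + 1) = 2 * x) ∨
    (triangleFactor a = 2 * x ∧ triangleFactor (a + 1) = 5 * x) := by
  induction a with
  | zero => exact ⟨1, le_rfl, .inl ⟨rfl, rfl⟩⟩
  | succ a ih =>
    obtain ⟨x, hx, ⟨h1, h2⟩ | ⟨h1, h2⟩⟩ := ih
    · exact ⟨x, hx, .inr ⟨h2, by rw [triangleFactor, h1]⟩⟩
    · exact ⟨5 * x, by omega, .inl ⟨h2, by rw [triangleFactor, h1]; ring⟩⟩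

lemma fiveVertexFactor_cases (r : ℕ) : ∃ y ≥ 1,
    (fiveVertexFactor r = y ∧ fiveVertexFactor (r + 1) = 4 * y) ∨
    (fiveVertexFactor r = 4 * y ∧ fiveVertexFactor (r + 1) = 17 * y) := by
  induction r with
  | zero => exact ⟨1, le_rfl, .inl ⟨rfl, rfl⟩⟩
  | succ r ih =>
    obtain ⟨x, hx, ⟨h1, h2⟩ | ⟨h1, h2⟩⟩ := ih
    · exact ⟨x, hx, .inr ⟨h2, by rw [fiveVertexFactor, h1]⟩⟩
    · exact ⟨17 * x, by omega, .inl ⟨h2, by rw [fiveVertexFactor, h1]; ring⟩⟩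

/-- The extremal numbers near `(a, r)`, up to a common factor. The four alternatives correspond to
the parities of `a` and `r`. -/
lemma extremal_cases (a r : ℕ) : ∃ m ≥ 1,
    extremal (a + 2) r = 5 * extremal a r ∧ extremal a (r + 2) = 17 * extremal a r ∧
    ((extremal a r = m ∧ extremal (a + 1) r = 2 * m ∧ extremal a (r + 1) = 4 * m ∧
        extremal (a + 1) (r + 1) = 8 * m) ∨
      (extremal a r = 2 * m ∧ extremal (a + 1) r = 5 * m ∧ extremal a (r + 1) = 8 * m ∧
        extremal (a + 1) (r + 1) = 20 * m) ∨
      (extremal a r = 4 * m ∧ extremal (a + 1) r = 8 * m ∧ extremal a (r + 1) = 17 * m ∧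
        extremal (a + 1) (r + 1) = 34 * m) ∨
      (extremal a r = 8 * m ∧ extremal (a + 1) r = 20 * m ∧ extremal a (r + 1) = 34 * m ∧
        extremal (a + 1) (r + 1) = 85 * m)) := by
  obtain ⟨x, hx, h⟩ := triangleFactor_cases a
  obtain ⟨y, hy, h'⟩ := fiveVertexFactor_cases r
  refine ⟨x * y, Nat.mul_pos hx hy, by simp only [extremal, triangleFactor]; ring,
    by simp only [extremal, fiveVertexFactor]; ring, ?_⟩
  simp only [extremal]
  rcases h with ⟨h1, h2⟩ | ⟨h1, h2⟩ <;> rcases h' with ⟨h3, h4⟩ | ⟨h3, h4⟩ <;>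
    rw [h1, h2, h3, h4]
  · exact .inl ⟨rfl, by ring, by ring, by ring⟩
  · exact .inr (.inr (.inl ⟨by ring, by ring, by ring, by ring⟩))
  · exact .inr (.inl ⟨by ring, by ring, by ring, by ring⟩)
  · exact .inr (.inr (.inr ⟨by ring, by ring, by ring, by ring⟩))

lemma extremal_pos (a r : ℕ) : 0 < extremal a r := by
  obtain ⟨m, hm, -, -, h⟩ := extremal_cases a r
  omega

/-! ### Joined vertex sets -/

/-- Every vertex of `A` is adjacent to every vertex of `D`. -/
def Joined (G : SimpleGraph V) (A D : Finset V) : Prop := ∀ x ∈ A, ∀ y ∈ D, G.Adj x y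

/-- No vertex of `A` outside a triangle of `G` in `A` is adjacent to a vertex of that triangle. -/
def IsolatedTrianglesOn (G : SimpleGraph V) (A : Finset V) : Prop :=
  ∀ ⦃x⦄, x ∈ A → ∀ ⦃y⦄, y ∈ A → ∀ ⦃z⦄, z ∈ A → G.Adj x y → G.Adj y z → G.Adj x z →
    ∀ ⦃v⦄, v ∈ A → G.Adj v x → v = y ∨ v = z

lemma IsolatedTrianglesOn.mono (h : IsolatedTrianglesOn G S) (hT : T ⊆ S) :
    IsolatedTrianglesOn G T :=
  fun _ hx _ hy _ hz h1 h2 h3 _ hv => h (hT hx) (hT hy) (hT hz) h1 h2 h3 (hT hv)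

variable {A D : Finset V}

lemma Joined.symm (h : Joined G A D) : Joined G D A := fun x hx y hy => (h y hy x hx).symm

lemma Joined.ssubset (h : Joined G A D) (hA : A ⊆ S) (hD : D ⊆ S) (hne : D.Nonempty) : A ⊂ S := by
  obtain ⟨d, hd⟩ := hne
  exact (Finset.ssubset_iff_of_subset hA).2 ⟨d, hD hd, fun hdA => G.irrefl (h d hdA d hd)⟩

lemma Joined.edgeFreeOn (h : Joined G A D) (hS : TriangleFreeOn G S) (hA : A ⊆ S) (hD : D ⊆ S)
    (hne : D.Nonempty) : EdgeFreeOn G A := by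
  obtain ⟨d, hd⟩ := hne
  exact fun x hx y hy hxy => hS (hA hx) (hA hy) (hD hd) hxy (h y hy d hd) (h x hx d hd)

/-- A third vertex of `A` would complete a `K₄` with two vertices on either side to a copy of
`twoJoinedK4`. -/
lemma Joined.card_le_two (h : Joined G A D) (hS : TwoJoinedFreeOn G S) (hA : A ⊆ S) (hD : D ⊆ S)
    (heA : ¬ EdgeFreeOn G A) (heD : ¬ EdgeFreeOn G D) : A.card ≤ 2 := by
  classical
  simp only [EdgeFreeOn, not_forall, not_not] at heA heD
  obtain ⟨x, hx, y, hy, hxy⟩ := heA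
  obtain ⟨z, hz, w, hw, hzw⟩ := heD
  by_contra! hcard
  obtain ⟨v, hv, hv'⟩ : ∃ v ∈ A, v ∉ ({x, y} : Finset V) :=
    Finset.exists_mem_notMem_of_card_lt_card (Finset.card_le_two.trans_lt hcard)
  simp only [Finset.mem_insert, Finset.mem_singleton, not_or] at hv'
  exact hS (hD hz) (hD hw) (hA hx) (hA hy) (hA hv)
    ⟨hzw, (h x hx z hz).symm, (h y hy z hz).symm, (h x hx w hw).symm, (h y hy w hw).symm, hxy⟩
    hv'.1 hv'.2 (h v hv z hz) (h v hv w hw)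

lemma Joined.card_le_one (h : Joined G A D) (hS : TwoJoinedFreeOn G S) (hA : A ⊆ S) (hD : D ⊆ S)
    (htA : ¬ TriangleFreeOn G A) : D.card ≤ 1 := by
  simp only [TriangleFreeOn, not_forall, not_not] at htA
  obtain ⟨x, hx, y, hy, z, hz, xy, yz, xz⟩ := htA
  rw [Finset.card_le_one]
  intro u hu v hv
  by_contra huv
  exact hS (hA hx) (hA hy) (hA hz) (hD hu) (hD hv)
    ⟨xy, xz, h x hx u hu, yz, h y hy u hu, h z hz u hu⟩ (h z hz v hv).ne' (Ne.symm huv)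
    (h x hx v hv).symm (h y hy v hv).symm

lemma Joined.isolatedTrianglesOn (h : Joined G A D) (hS : TwoJoinedFreeOn G S) (hA : A ⊆ S)
    (hD : D ⊆ S) (hne : D.Nonempty) : IsolatedTrianglesOn G A := by
  obtain ⟨d, hd⟩ := hne
  intro x hx y hy z hz xy yz xz v hv hvx
  by_contra! hcon
  exact hS (hA hx) (hD hd) (hA hy) (hA hz) (hA hv)
    ⟨h x hx d hd, xy, xz, (h y hy d hd).symm, (h z hz d hd).symm, yz⟩ hcon.1 hcon.2 hvx
    (h v hv d hd)

/-- If the triangles in `A` are isolated, one vertex of each of them can be removed so that at least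
two thirds of `A` remain. -/
lemma IsolatedTrianglesOn.exists_triangleFreeOn (h : IsolatedTrianglesOn G A) :
    ∃ A' ⊆ A, TriangleFreeOn G A' ∧ 2 * A.card ≤ 3 * A'.card := by
  classical
  obtain ⟨A', hA'⟩ : ∃ A', Maximal (fun T => T ⊆ A ∧ TriangleFreeOn G T) A' := by
    refine Set.Finite.exists_maximal (s := {T | T ⊆ A ∧ TriangleFreeOn G T}) ?_ ⟨∅, by simp, ?_⟩
    · exact (A.powerset.finite_toSet).subset fun T hT => by simpa using hT.1
    · intro x hx
      simp at hx
  have hsub := hA'.prop.1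
  refine ⟨A', hsub, hA'.prop.2, ?_⟩
  -- Each removed vertex forms a triangle with its two neighbours in `A'`, by maximality.
  have hex : ∀ v ∈ A \ A', ∃ x ∈ A', ∃ y ∈ A', G.Adj v x ∧ G.Adj v y ∧ G.Adj x y := by
    intro v hv
    rw [Finset.mem_sdiff] at hv
    have hnot : ¬ TriangleFreeOn G (insert v A') := fun ht =>
      hv.2 (hA'.le_of_ge ⟨Finset.insert_subset hv.1 hsub, ht⟩ (Finset.subset_insert v A')
        (Finset.mem_insert_self v A'))
    simp only [TriangleFreeOn, not_forall, not_not] at hnot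
    obtain ⟨x, hx, y, hy, z, hz, xy, yz, xz⟩ := hnot
    have hfree := hA'.prop.2
    rw [Finset.mem_insert] at hx hy hz
    rcases hx with rfl | hx
    · exact ⟨y, hy.resolve_left xy.ne', z, hz.resolve_left xz.ne', xy, xz, yz⟩
    rcases hy with rfl | hy
    · exact ⟨x, hx, z, hz.resolve_left yz.ne', xy.symm, yz, xz⟩
    rcases hz with rfl | hz
    · exact ⟨x, hx, y, hy, xz.symm, yz.symm, xy⟩
    · exact (hfree hx hy hz xy yz xz).elim
  have hdisj : Set.PairwiseDisjoint ((A \ A' : Finset V) : Set V) fun v => A'.filter (G.Adj v) := by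
    intro v hv u hu hvu
    rw [Function.onFun, Finset.disjoint_left]
    intro x hxv hxu
    rw [Finset.mem_filter] at hxv hxu
    obtain ⟨a, ha, b, hb, hva, hvb, hab⟩ := hex v hv
    rw [Finset.mem_coe, Finset.mem_sdiff] at hv hu
    -- The triangle of `v` contains `x`, hence also `u`, although `u` is not in `A'`.
    have hxab : x = a ∨ x = b :=
      h hv.1 (hsub ha) (hsub hb) hva hab hvb (hsub hxv.1) hxv.2.symm
    rcases hxab with rfl | rfl
    · rcases h (hsub hxv.1) hv.1 (hsub hb) hva.symm hvb hab hu.1 hxu.2 with rfl | rfl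
      exacts [hvu rfl, hu.2 hb]
    · rcases h (hsub hxv.1) hv.1 (hsub ha) hvb.symm hva hab.symm hu.1 hxu.2 with rfl | rfl
      exacts [hvu rfl, hu.2 ha]
  have hcard := Finset.card_biUnion hdisj
  have hle : ((A \ A').biUnion fun v => A'.filter (G.Adj v)).card ≤ A'.card :=
    Finset.card_le_card (Finset.biUnion_subset.2 fun v _ => Finset.filter_subset _ _)
  have hge : 2 * (A \ A').card ≤ ∑ v ∈ A \ A', (A'.filter (G.Adj v)).card := by
    rw [mul_comm, ← smul_eq_mul]
    refine Finset.card_nsmul_le_sum _ _ _ fun v hv => ?_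
    obtain ⟨x, hx, y, hy, hvx, hvy, hxy⟩ := hex v hv
    exact Finset.one_lt_card.2 ⟨x, by simp [hx, hvx], y, by simp [hy, hvy], hxy.ne⟩
  have := Finset.card_sdiff_add_card_eq_card hsub
  omega

/-- A bound for two vertex sets joined in `G`, given bounds `e` and `t` for vertex sets without an
edge and without a triangle of `G`. -/
lemma Joined.card_add_card_le (h : Joined G A D) (hS : TwoJoinedFreeOn G S) (hA : A ⊆ S)
    (hD : D ⊆ S) (hneA : A.Nonempty) (hneD : D.Nonempty) {e t : ℕ}
    (he : ∀ T ⊂ S, EdgeFreeOn G T → T.card ≤ e) (ht : ∀ T ⊂ S, TriangleFreeOn G T → T.card ≤ t) :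
    A.card + D.card ≤ 4 ∨ A.card + D.card ≤ e + t ∨ 2 * (A.card + D.card) ≤ 3 * t + 2 := by
  have key : ∀ {A D : Finset V}, Joined G A D → A ⊆ S → D ⊆ S → A.Nonempty → D.Nonempty →
      EdgeFreeOn G D → A.card + D.card ≤ e + t ∨ 2 * (A.card + D.card) ≤ 3 * t + 2 := by
    intro A D h hA hD hneA hneD heD
    have hAS := h.ssubset hA hD hneD
    have hDe := he D (h.symm.ssubset hD hA hneA) heD
    by_cases htA : TriangleFreeOn G A
    · have := ht A hAS htA
      omega
    · have := h.card_le_one hS hA hD htA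
      obtain ⟨A', hA', hfree, hcard⟩ :=
        (h.isolatedTrianglesOn hS hA hD hneD).exists_triangleFreeOn
      have := ht A' (hA'.trans_ssubset hAS) hfree
      omega
  by_cases heD : EdgeFreeOn G D
  · exact .inr (key h hA hD hneA hneD heD)
  by_cases heA : EdgeFreeOn G A
  · have := key h.symm hD hA hneD hneA heA
    omega
  · have h1 := h.card_le_two hS hA hD heA heD
    have h2 := h.symm.card_le_two hS hD hA heD heA
    omega

/-! ### Parts of a Gallai partition -/

/-- Induction hypothesis for two color classes `R` and `B`: bounds for the proper subsets of `S`,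
where the other colors account for `a` forbidden triangles and `r` forbidden five-vertex graphs. -/
structure SubsetBounds (R B : SimpleGraph V) (S : Finset V) (a r : ℕ) : Prop where
  edge_edge : ∀ T ⊂ S, EdgeFreeOn R T → EdgeFreeOn B T → T.card ≤ extremal a r
  triangle_edge : ∀ T ⊂ S, TriangleFreeOn R T → EdgeFreeOn B T → T.card ≤ extremal (a + 1) r
  edge_triangle : ∀ T ⊂ S, EdgeFreeOn R T → TriangleFreeOn B T → T.card ≤ extremal (a + 1) r
  triangle_triangle :
    ∀ T ⊂ S, TriangleFreeOn R T → TriangleFreeOn B T → T.card ≤ extremal (a + 2) r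
  edge_twoJoined : ∀ T ⊂ S, EdgeFreeOn R T → TwoJoinedFreeOn B T → T.card ≤ extremal a (r + 1)
  twoJoined_edge : ∀ T ⊂ S, TwoJoinedFreeOn R T → EdgeFreeOn B T → T.card ≤ extremal a (r + 1)
  triangle_twoJoined :
    ∀ T ⊂ S, TriangleFreeOn R T → TwoJoinedFreeOn B T → T.card ≤ extremal (a + 1) (r + 1)
  twoJoined_triangle :
    ∀ T ⊂ S, TwoJoinedFreeOn R T → TriangleFreeOn B T → T.card ≤ extremal (a + 1) (r + 1)

/-- The part `U` of a partition of `S` is joined to the nonempty sets `DR` and `DB` in the graphs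
`R` and `B`. -/
structure IsPart (R B : SimpleGraph V) (S U DR DB : Finset V) : Prop where
  subset : U ⊆ S
  subset_left : DR ⊆ S
  subset_right : DB ⊆ S
  nonempty : U.Nonempty
  nonempty_left : DR.Nonempty
  nonempty_right : DB.Nonempty
  joined_left : Joined R U DR
  joined_right : Joined B U DB

variable {U DR DB : Finset V} {a r : ℕ}

lemma SubsetBounds.symm (h : SubsetBounds R B S a r) : SubsetBounds B R S a r :=
  ⟨fun T hT h1 h2 => h.edge_edge T hT h2 h1, fun T hT h1 h2 => h.edge_triangle T hT h2 h1,
    fun T hT h1 h2 => h.triangle_edge T hT h2 h1,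
    fun T hT h1 h2 => h.triangle_triangle T hT h2 h1,
    fun T hT h1 h2 => h.twoJoined_edge T hT h2 h1, fun T hT h1 h2 => h.edge_twoJoined T hT h2 h1,
    fun T hT h1 h2 => h.twoJoined_triangle T hT h2 h1,
    fun T hT h1 h2 => h.triangle_twoJoined T hT h2 h1⟩

namespace IsPart

lemma symm (h : IsPart R B S U DR DB) : IsPart B R S U DB DR :=
  ⟨h.subset, h.subset_right, h.subset_left, h.nonempty, h.nonempty_right, h.nonempty_left,
    h.joined_right, h.joined_left⟩

lemma ssubset (h : IsPart R B S U DR DB) : U ⊂ S :=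
  h.joined_left.ssubset h.subset h.subset_left h.nonempty_left

lemma ssubset_left (h : IsPart R B S U DR DB) : DR ⊂ S :=
  h.joined_left.symm.ssubset h.subset_left h.subset h.nonempty

lemma ssubset_right (h : IsPart R B S U DR DB) : DB ⊂ S := h.symm.ssubset_left

/-- A part with an edge of `B`, when triangles are forbidden in `R` and `twoJoinedK4` in `B`. -/
lemma card_le_of_triangleFreeOn (h : IsPart R B S U DR DB) (hb : SubsetBounds R B S a r)
    (hR : TriangleFreeOn R S) (hB : TwoJoinedFreeOn B S) (hU : ¬ EdgeFreeOn B U) :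
    U.card + DR.card + DB.card ≤ extremal (a + 1) (r + 1) := by
  obtain ⟨m, hm, -, -, hcases⟩ := extremal_cases a r
  have hUR := h.joined_left.edgeFreeOn hR h.subset h.subset_left h.nonempty_left
  have hDR := hb.edge_twoJoined DR h.ssubset_left
    (h.joined_left.symm.edgeFreeOn hR h.subset_left h.subset h.nonempty) (hB.mono h.subset_left)
  by_cases hUt : TriangleFreeOn B U
  · by_cases hDB : EdgeFreeOn B DB
    · have h1 := hb.edge_triangle U h.ssubset hUR hUt
      have h2 := hb.triangle_edge DB h.ssubset_right (hR.mono h.subset_right) hDB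
      omega
    · have h1 := h.joined_right.card_le_two hB h.subset h.subset_right hU hDB
      have h2 := h.joined_right.symm.card_le_two hB h.subset_right h.subset hDB hU
      omega
  · have h1 := h.joined_right.card_le_one hB h.subset h.subset_right hUt
    obtain ⟨U', hU', hfree, hcard⟩ := (h.joined_right.isolatedTrianglesOn hB h.subset
      h.subset_right h.nonempty_right).exists_triangleFreeOn
    have h2 := hb.edge_triangle U' (hU'.trans_ssubset h.ssubset) (hUR.mono hU') hfree
    omega

/-- A part with a triangle of `R`, when `twoJoinedK4` is forbidden in `R` and `B`. -/
lemma card_le_of_not_triangleFreeOn (h : IsPart R B S U DR DB) (hb : SubsetBounds R B S a r)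
    (hR : TwoJoinedFreeOn R S) (hB : TwoJoinedFreeOn B S) (hU : ¬ TriangleFreeOn R U) :
    U.card + DR.card + DB.card ≤ extremal a (r + 2) := by
  obtain ⟨m, hm, h5, h17, hcases⟩ := extremal_cases a r
  have hDR := h.joined_left.card_le_one hR h.subset h.subset_left hU
  obtain ⟨U', hU', hfree, hcard⟩ := (h.joined_left.isolatedTrianglesOn hR h.subset
    h.subset_left h.nonempty_left).exists_triangleFreeOn
  have hU'S := hU'.trans_ssubset h.ssubset
  have h3 : 3 ≤ U.card := by
    simp only [TriangleFreeOn, not_forall, not_not] at hU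
    obtain ⟨x, hx, y, hy, z, hz, xy, yz, xz⟩ := hU
    exact Finset.two_lt_card_iff.2 ⟨x, y, z, hx, hy, hz, xy.ne, xz.ne, yz.ne⟩
  by_cases hUt : TriangleFreeOn B U
  · by_cases hUe : EdgeFreeOn B U
    · have h1 := hb.triangle_edge U' hU'S hfree (hUe.mono hU')
      have hDBt : TriangleFreeOn B DB := by
        by_contra hcon
        have := h.joined_right.symm.card_le_one hB h.subset_right h.subset hcon
        omega
      have h2 := hb.twoJoined_triangle DB h.ssubset_right (hR.mono h.subset_right) hDBt
      omega
    · have h1 := hb.triangle_triangle U' hU'S hfree (hUt.mono hU')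
      have hDBe : EdgeFreeOn B DB := by
        by_contra hcon
        have := h.joined_right.card_le_two hB h.subset h.subset_right hUe hcon
        omega
      have h2 := hb.twoJoined_edge DB h.ssubset_right (hR.mono h.subset_right) hDBe
      omega
  · have hDB := h.joined_right.card_le_one hB h.subset h.subset_right hUt
    obtain ⟨U'', hU'', hfree', hcard'⟩ := ((h.joined_right.isolatedTrianglesOn hB h.subset
      h.subset_right h.nonempty_right).mono hU').exists_triangleFreeOn
    have := hb.triangle_triangle U'' (hU''.trans_ssubset hU'S) (hfree.mono hU'') hfree'
    omega

/-- A part with an edge of `R` but no triangle of `R` or `B`, when `twoJoinedK4` is forbidden in `R`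
and `B`. The induction hypothesis for `DR` alone does not suffice if `a` and `r` are both odd. -/
lemma card_le_of_not_edgeFreeOn (h : IsPart R B S U DR DB) (hb : SubsetBounds R B S a r)
    (hR : TwoJoinedFreeOn R S) (hB : TwoJoinedFreeOn B S) (hU : ¬ EdgeFreeOn R U)
    (hUR : TriangleFreeOn R U) (hUB : TriangleFreeOn B U)
    (hDR : EdgeFreeOn R DR → DR.card ≤ 4 ∨ DR.card ≤ extremal a r + extremal (a + 1) r ∨
      2 * DR.card ≤ 3 * extremal (a + 1) r + 2) :
    U.card + DR.card + DB.card ≤ extremal a (r + 2) := by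
  obtain ⟨m, hm, h5, h17, hcases⟩ := extremal_cases a r
  have h2 : 2 ≤ U.card := by
    simp only [EdgeFreeOn, not_forall, not_not] at hU
    obtain ⟨x, hx, y, hy, xy⟩ := hU
    exact Finset.one_lt_card.2 ⟨x, hx, y, hy, xy.ne⟩
  have hDBt : TriangleFreeOn B DB := by
    by_contra hcon
    have := h.joined_right.symm.card_le_one hB h.subset_right h.subset hcon
    omega
  have hDB := hb.twoJoined_triangle DB h.ssubset_right (hR.mono h.subset_right) hDBt
  by_cases hDRe : EdgeFreeOn R DR
  · have hDR' := hb.edge_twoJoined DR h.ssubset_left hDRe (hB.mono h.subset_left)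
    by_cases hUe : EdgeFreeOn B U
    · have h1 := hb.triangle_edge U h.ssubset hUR hUe
      have h3 := hDR hDRe
      omega
    · by_cases hDBe : EdgeFreeOn B DB
      · have h1 := hb.triangle_triangle U h.ssubset hUR hUB
        have h3 := hb.twoJoined_edge DB h.ssubset_right (hR.mono h.subset_right) hDBe
        omega
      · have h1 := h.joined_right.card_le_two hB h.subset h.subset_right hUe hDBe
        have h3 := h.joined_right.symm.card_le_two hB h.subset_right h.subset hDBe hUe
        omega
  · have h1 := h.joined_left.card_le_two hR h.subset h.subset_left hU hDRe
    have h3 := h.joined_left.symm.card_le_two hR h.subset_left h.subset hDRe hU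
    omega

end IsPart

/-! ### Induction step -/

section Step

variable {K : Type*} {c : TopEdgeLabeling V K} {P : V → V} {i j : K}

/-- The vertices of `S` in the same part as `x`. -/
def part [DecidableEq V] (S : Finset V) (P : V → V) (x : V) : Finset V :=
  S.filter fun y => P y = P x

open scoped Classical in
/-- The vertices of `S` outside the part of `x` that are adjacent to `x` in `G`. -/
noncomputable def outside (S : Finset V) (P : V → V) (G : SimpleGraph V) (x : V) : Finset V :=
  S.filter fun y => P y ≠ P x ∧ G.Adj x y

lemma mem_part [DecidableEq V] {x y : V} : y ∈ part S P x ↔ y ∈ S ∧ P y = P x := Finset.mem_filter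

lemma mem_outside {x y : V} : y ∈ outside S P G x ↔ y ∈ S ∧ P y ≠ P x ∧ G.Adj x y := by
  classical exact Finset.mem_filter

lemma outside_subset (S : Finset V) (P : V → V) (G : SimpleGraph V) (x : V) :
    outside S P G x ⊆ S :=
  fun _ hy => (mem_outside.1 hy).1

namespace IsGallaiPartition

lemma symm (h : IsGallaiPartition c S P i j) : IsGallaiPartition c S P j i :=
  ⟨h.nontrivial, fun x hx y hy hxy => (h.adj_or x hx y hy hxy).symm, h.homogeneous⟩

variable [DecidableEq V]

lemma joined_outside (h : IsGallaiPartition c S P i j) {x : V} (hx : x ∈ S) (l : K) :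
    Joined (c.labelGraph l) (part S P x) (outside S P (c.labelGraph l) x) := by
  intro y hy z hz
  rw [mem_part] at hy
  rw [mem_outside] at hz
  exact h.homogeneous x hx y hy.1 z hz.1 hy.2.symm (Ne.symm hz.2.1) l hz.2.2

lemma isPart (h : IsGallaiPartition c S P i j) {x : V} (hx : x ∈ S)
    (hi : (outside S P (c.labelGraph i) x).Nonempty)
    (hj : (outside S P (c.labelGraph j) x).Nonempty) :
    IsPart (c.labelGraph i) (c.labelGraph j) S (part S P x) (outside S P (c.labelGraph i) x)
      (outside S P (c.labelGraph j) x) :=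
  ⟨Finset.filter_subset _ _, outside_subset .., outside_subset ..,
    ⟨x, mem_part.2 ⟨hx, rfl⟩⟩, hi, hj, h.joined_outside hx i, h.joined_outside hx j⟩

lemma card_le (h : IsGallaiPartition c S P i j) {x : V} (hx : x ∈ S) :
    S.card ≤ (part S P x).card + (outside S P (c.labelGraph i) x).card +
      (outside S P (c.labelGraph j) x).card := by
  have hsub : S ⊆ part S P x ∪ outside S P (c.labelGraph i) x ∪
      outside S P (c.labelGraph j) x := by
    intro y hy
    simp only [Finset.mem_union, mem_part, mem_outside]
    by_cases hxy : P y = P x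
    · simp [hy, hxy]
    · have := h.adj_or x hx y hy (Ne.symm hxy)
      tauto
  exact (Finset.card_le_card hsub).trans ((Finset.card_union_le _ _).trans
    (Nat.add_le_add_right (Finset.card_union_le _ _) _))

/-- A bound for the vertices that a part sees in the color `i`, when they span no edge of color `i`.
They consist of whole parts, and different parts among them are joined in the color `j`. -/
lemma card_outside_le (h : IsGallaiPartition c S P i j)
    (hb : SubsetBounds (c.labelGraph i) (c.labelGraph j) S a r)
    (hB : TwoJoinedFreeOn (c.labelGraph j) S)
    (ht : ∀ y ∈ S, TriangleFreeOn (c.labelGraph j) (part S P y)) {x : V} (hx : x ∈ S)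
    (hne : (outside S P (c.labelGraph i) x).Nonempty)
    (he : EdgeFreeOn (c.labelGraph i) (outside S P (c.labelGraph i) x)) :
    (outside S P (c.labelGraph i) x).card ≤ 4 ∨
      (outside S P (c.labelGraph i) x).card ≤ extremal a r + extremal (a + 1) r ∨
      2 * (outside S P (c.labelGraph i) x).card ≤ 3 * extremal (a + 1) r + 2 := by
  set D := outside S P (c.labelGraph i) x with hD
  have hDS : D ⊆ S := outside_subset ..
  have hDss : D ⊂ S := (Finset.ssubset_iff_of_subset hDS).2
    ⟨x, hx, fun hxD => (mem_outside.1 hxD).2.1 rfl⟩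
  obtain ⟨y, hy⟩ := hne
  have hy' := mem_outside.1 hy
  have hsub : part S P y ⊆ D := by
    intro z hz
    rw [mem_part] at hz
    refine mem_outside.2 ⟨hz.1, hz.2 ▸ hy'.2.1, ?_⟩
    exact (h.homogeneous y hy'.1 z hz.1 x hx hz.2.symm hy'.2.1 i hy'.2.2.symm).symm
  have hjoin : Joined (c.labelGraph j) (part S P y) (D \ part S P y) := by
    intro u hu v hv
    rw [Finset.mem_sdiff] at hv
    have huS := mem_part.1 hu
    have hvS := (mem_outside.1 hv.1).1
    have hne : P u ≠ P v := fun h => hv.2 (mem_part.2 ⟨hvS, h.symm.trans huS.2⟩)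
    exact (h.adj_or u huS.1 v hvS hne).resolve_left (he (hsub hu) hv.1)
  have hcard := Finset.card_sdiff_add_card_eq_card hsub
  rcases (D \ part S P y).eq_empty_or_nonempty with h0 | h0
  · have := hb.edge_triangle _ (hsub.trans_ssubset hDss) (he.mono hsub) (ht y hy'.1)
    rw [h0, Finset.card_empty] at hcard
    omega
  · have := hjoin.card_add_card_le (hB.mono hDS) hsub Finset.sdiff_subset
      ⟨y, mem_part.2 ⟨hy'.1, rfl⟩⟩ h0
      (fun T hT hTe => hb.edge_edge T (hT.trans hDss) (he.mono hT.subset) hTe)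
      (fun T hT hTt => hb.edge_triangle T (hT.trans hDss) (he.mono hT.subset) hTt)
    omega

/-- The bound in terms of the number `q` of parts, when no part has an edge of color `i` or `j`. -/
lemma card_le_mul (h : IsGallaiPartition c S P i j)
    (hb : SubsetBounds (c.labelGraph i) (c.labelGraph j) S a r)
    (hi : ∀ y ∈ S, EdgeFreeOn (c.labelGraph i) (part S P y))
    (hj : ∀ y ∈ S, EdgeFreeOn (c.labelGraph j) (part S P y)) {q : ℕ}
    (hq : ∀ Q ⊆ S, (∀ x ∈ Q, ∀ y ∈ Q, x ≠ y →
      (c.labelGraph i).Adj x y ∨ (c.labelGraph j).Adj x y) → Q.card ≤ q) :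
    S.card ≤ extremal a r * q := by
  obtain ⟨Q, hQS, hinj, himg⟩ := Finset.exists_subset_injOn_image_eq_of_surjOn S (S.image P)
    (f := P) (fun x hx => by simpa using hx)
  have hQ := hq Q hQS fun x hx y hy hxy =>
    h.adj_or x (hQS hx) y (hQS hy) fun hP => hxy (hinj hx hy hP)
  have hcard : (S.image P).card ≤ q := himg ▸ Finset.card_image_le.trans hQ
  refine (Finset.card_le_mul_card_image S (extremal a r) ?_).trans (Nat.mul_le_mul_left _ hcard)
  intro b hb'
  obtain ⟨x, hx, rfl⟩ := Finset.mem_image.1 hb'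
  refine hb.edge_edge (part S P x) ?_ (hi x hx) (hj x hx)
  refine (Finset.ssubset_iff_of_subset (Finset.filter_subset _ _)).2 ?_
  obtain ⟨u, hu, v, hv, huv⟩ := h.nontrivial
  by_cases hux : P u = P x
  · exact ⟨v, hv, fun hvx => huv (hux.trans (mem_part.1 hvx).2.symm)⟩
  · exact ⟨u, hu, fun hux' => hux (mem_part.1 hux').2⟩

end IsGallaiPartition

end Step

/-! ### The upper bound -/

/-- What is forbidden in a color class: an edge, a triangle, or a five-vertex graph. -/
inductive Target
  | edge
  | triangle
  | fiveVertex
  deriving DecidableEq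

/-- The graph `G` has no copy of the forbidden graph inside `S`, which is `twoJoinedK4` in the
five-vertex case. -/
def AvoidsOn (G : SimpleGraph V) (S : Finset V) : Target → Prop
  | .edge => EdgeFreeOn G S
  | .triangle => TriangleFreeOn G S
  | .fiveVertex => TwoJoinedFreeOn G S

lemma AvoidsOn.mono {t : Target} (h : AvoidsOn G S t) (hT : T ⊆ S) : AvoidsOn G T t := by
  cases t
  exacts [EdgeFreeOn.mono h hT, TriangleFreeOn.mono h hT, TwoJoinedFreeOn.mono h hT]

lemma avoidsOn_update {K : Type*} [DecidableEq K] {c : TopEdgeLabeling V K} {ℓ : K → Target} {i : K}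
    {s : Target} (hℓ : ∀ k, AvoidsOn (c.labelGraph k) S (ℓ k))
    (hs : AvoidsOn (c.labelGraph i) S s) (k : K) :
    AvoidsOn (c.labelGraph k) S (Function.update ℓ i s k) := by
  by_cases hk : k = i
  · subst hk; simpa using hs
  · simpa [hk] using hℓ k

section

variable {K : Type*} [Fintype K] [DecidableEq K]

/-- The number of colors with forbidden graph `t`. -/
def count (ℓ : K → Target) (t : Target) : ℕ := (Finset.univ.filter fun i => ℓ i = t).card

/-- The extremal number for the forbidden graphs `ℓ`. -/
def bound (ℓ : K → Target) : ℕ := extremal (count ℓ .triangle) (count ℓ .fiveVertex)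

lemma count_update (ℓ : K → Target) (i : K) (s : Target) {t : Target} (ht : t ≠ .edge) :
    count (Function.update ℓ i s) t =
      count (Function.update ℓ i .edge) t + if s = t then 1 else 0 := by
  have h0 : (Finset.univ.filter fun k => Function.update ℓ i .edge k = t) =
      (Finset.univ.erase i).filter fun k => ℓ k = t := by
    ext k
    by_cases hk : k = i
    · subst hk; simp [ht.symm]
    · simp [hk]
  have h1 : (Finset.univ.filter fun k => Function.update ℓ i s k = t) =
      if s = t then insert i ((Finset.univ.erase i).filter fun k => ℓ k = t)
      else (Finset.univ.erase i).filter fun k => ℓ k = t := by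
    ext k
    by_cases hk : k = i
    · subst hk; split_ifs <;> simp_all
    · split_ifs <;> simp [hk]
  rw [count, count, h0, h1]
  split_ifs
  · rw [Finset.card_insert_of_notMem (by simp)]
  · rfl

lemma bound_update (ℓ : K → Target) (i : K) (s : Target) :
    bound (Function.update ℓ i s) =
      extremal (count (Function.update ℓ i .edge) .triangle + if s = .triangle then 1 else 0)
        (count (Function.update ℓ i .edge) .fiveVertex + if s = .fiveVertex then 1 else 0) := by
  rw [bound, count_update _ _ _ (t := .triangle) (by decide),
    count_update _ _ _ (t := .fiveVertex) (by decide)]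

lemma bound_update_update (ℓ : K → Target) {i j : K} (hij : i ≠ j) (s t : Target) :
    bound (Function.update (Function.update ℓ i s) j t) =
      extremal (count (Function.update (Function.update ℓ i .edge) j .edge) .triangle +
          (if s = .triangle then 1 else 0) + if t = .triangle then 1 else 0)
        (count (Function.update (Function.update ℓ i .edge) j .edge) .fiveVertex +
          (if s = .fiveVertex then 1 else 0) + if t = .fiveVertex then 1 else 0) := by
  rw [bound_update, Function.update_comm hij, Function.update_comm hij,
    count_update _ i s (t := .triangle) (by decide),
    count_update _ i s (t := .fiveVertex) (by decide)]

variable {c : TopEdgeLabeling V K} {ℓ : K → Target}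

/-- The induction step for a vertex set split into two parts joined in a single color. -/
lemma card_le_bound_of_joined (ih : ∀ T ⊂ S, ∀ ℓ : K → Target,
      (∀ i, AvoidsOn (c.labelGraph i) T (ℓ i)) → T.card ≤ bound ℓ)
    (hℓ : ∀ i, AvoidsOn (c.labelGraph i) S (ℓ i)) {i : K} (hj : Joined (c.labelGraph i) A D)
    (hA : A ⊆ S) (hD : D ⊆ S) (hneA : A.Nonempty) (hneD : D.Nonempty)
    (hcard : S.card ≤ A.card + D.card) : S.card ≤ bound ℓ := by
  obtain ⟨m, hm, h5, h17, hcases⟩ := extremal_cases (count (Function.update ℓ i .edge) .triangle)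
    (count (Function.update ℓ i .edge) .fiveVertex)
  have ih' : ∀ T ⊂ S, ∀ s, AvoidsOn (c.labelGraph i) T s →
      T.card ≤ bound (Function.update ℓ i s) := fun T hT s hs =>
    ih T hT _ (avoidsOn_update (fun k => (hℓ k).mono hT.subset) hs)
  have he : ∀ T ⊂ S, EdgeFreeOn (c.labelGraph i) T → T.card ≤ _ := fun T hT h => ih' T hT .edge h
  have ht : ∀ T ⊂ S, TriangleFreeOn (c.labelGraph i) T → T.card ≤ _ :=
    fun T hT h => ih' T hT .triangle h
  have hi := hℓ i
  rw [← Function.update_eq_self i ℓ]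
  rw [bound_update] at he ht ⊢
  have hAS := hj.ssubset hA hD hneD
  have hDS := hj.symm.ssubset hD hA hneA
  cases hs : ℓ i <;> rw [hs] at hi <;> simp only [reduceIte, reduceCtorEq, add_zero] at he ht ⊢
  · obtain ⟨x, hx⟩ := hneA
    obtain ⟨y, hy⟩ := hneD
    exact (hi (hA hx) (hD hy) (hj x hx y hy)).elim
  · have h1 := he A hAS (hj.edgeFreeOn hi hA hD hneD)
    have h2 := he D hDS (hj.symm.edgeFreeOn hi hD hA hneA)
    omega
  · have := hj.card_add_card_le hi hA hD hneA hneD he ht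
    omega

/-- The induction step for a Gallai partition in which every vertex sees both colors outside its
part. -/
lemma IsGallaiPartition.card_le_bound [DecidableEq V] {P : V → V} {i j : K}
    (h : IsGallaiPartition c S P i j) (hij : i ≠ j)
    (ih : ∀ T ⊂ S, ∀ ℓ : K → Target,
      (∀ i, AvoidsOn (c.labelGraph i) T (ℓ i)) → T.card ≤ bound ℓ)
    (hℓ : ∀ i, AvoidsOn (c.labelGraph i) S (ℓ i))
    (hi : ∀ x ∈ S, (outside S P (c.labelGraph i) x).Nonempty)
    (hj : ∀ x ∈ S, (outside S P (c.labelGraph j) x).Nonempty) : S.card ≤ bound ℓ := by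
  set a := count (Function.update (Function.update ℓ i .edge) j .edge) .triangle with ha
  set r := count (Function.update (Function.update ℓ i .edge) j .edge) .fiveVertex with hr
  have hbound := bound_update_update ℓ hij
  rw [← ha, ← hr] at hbound
  have ih' : ∀ T ⊂ S, ∀ s t, AvoidsOn (c.labelGraph i) T s → AvoidsOn (c.labelGraph j) T t →
      T.card ≤ extremal (a + (if s = .triangle then 1 else 0) + if t = .triangle then 1 else 0)
        (r + (if s = .fiveVertex then 1 else 0) + if t = .fiveVertex then 1 else 0) := by
    intro T hT s t hs ht
    rw [← hbound]
    exact ih T hT _ (avoidsOn_update (avoidsOn_update (fun k => (hℓ k).mono hT.subset) hs) ht)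
  have hb : SubsetBounds (c.labelGraph i) (c.labelGraph j) S a r :=
    ⟨fun T hT h1 h2 => ih' T hT .edge .edge h1 h2,
      fun T hT h1 h2 => ih' T hT .triangle .edge h1 h2,
      fun T hT h1 h2 => ih' T hT .edge .triangle h1 h2,
      fun T hT h1 h2 => ih' T hT .triangle .triangle h1 h2,
      fun T hT h1 h2 => ih' T hT .edge .fiveVertex h1 h2,
      fun T hT h1 h2 => ih' T hT .fiveVertex .edge h1 h2,
      fun T hT h1 h2 => ih' T hT .triangle .fiveVertex h1 h2,
      fun T hT h1 h2 => ih' T hT .fiveVertex .triangle h1 h2⟩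
  have hpart := fun x hx => h.isPart hx (hi x hx) (hj x hx)
  have hpart' := fun x hx => h.symm.isPart hx (hj x hx) (hi x hx)
  have hcard := fun x hx => h.card_le (x := x) hx
  have hcard' := fun x hx => h.symm.card_le (x := x) hx
  obtain ⟨x₀, hx₀, -⟩ := h.nontrivial
  have hiS := hℓ i
  have hjS := hℓ j
  have hbound' := hbound (ℓ i) (ℓ j)
  rw [Function.update_eq_self, Function.update_eq_self] at hbound'
  obtain ⟨m, hm, h5, h17, hcases⟩ := extremal_cases a r
  -- Triangles forbidden in the color `i`, five-vertex graphs in the color `j`, or conversely.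
  have mixed : ∀ {i j : K}, IsGallaiPartition c S P i j →
      SubsetBounds (c.labelGraph i) (c.labelGraph j) S a r →
      (∀ x ∈ S, IsPart (c.labelGraph i) (c.labelGraph j) S (part S P x)
        (outside S P (c.labelGraph i) x) (outside S P (c.labelGraph j) x)) →
      TriangleFreeOn (c.labelGraph i) S → TwoJoinedFreeOn (c.labelGraph j) S →
      S.card ≤ extremal (a + 1) (r + 1) := by
    intro i j h hb hpart hiS hjS
    by_cases hex : ∃ x ∈ S, ¬ EdgeFreeOn (c.labelGraph j) (part S P x)
    · obtain ⟨x, hx, hxe⟩ := hex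
      exact (h.card_le hx).trans ((hpart x hx).card_le_of_triangleFreeOn hb hiS hjS hxe)
    · push Not at hex
      have := h.card_le_mul hb (fun x hx => (hpart x hx).joined_left.edgeFreeOn hiS
        (hpart x hx).subset (hpart x hx).subset_left (hpart x hx).nonempty_left) hex (q := 8)
        fun Q hQ hQ' => card_le_eight hQ' (hiS.mono hQ) (hjS.mono hQ)
      omega
  cases hs : ℓ i <;> cases ht : ℓ j <;> rw [hs] at hiS hbound' <;> rw [ht] at hjS hbound' <;>
    simp only [reduceIte, reduceCtorEq, add_zero] at hbound' <;> rw [hbound']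
  case edge.edge | edge.triangle | edge.fiveVertex =>
    obtain ⟨y, hy⟩ := hi x₀ hx₀
    exact (hiS hx₀ (mem_outside.1 hy).1 (mem_outside.1 hy).2.2).elim
  case triangle.edge | fiveVertex.edge =>
    obtain ⟨y, hy⟩ := hj x₀ hx₀
    exact (hjS hx₀ (mem_outside.1 hy).1 (mem_outside.1 hy).2.2).elim
  case triangle.triangle =>
    have := h.card_le_mul hb (fun x hx => (hpart x hx).joined_left.edgeFreeOn hiS
        (hpart x hx).subset (hpart x hx).subset_left (hpart x hx).nonempty_left)
      (fun x hx => (hpart x hx).joined_right.edgeFreeOn hjS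
        (hpart x hx).subset (hpart x hx).subset_right (hpart x hx).nonempty_right) (q := 5)
      fun Q hQ hQ' => card_le_five hQ' (hiS.mono hQ) (hjS.mono hQ)
    have h2 : extremal (a + 1 + 1) r = 5 * extremal a r := h5
    omega
  case triangle.fiveVertex => exact mixed h hb hpart hiS hjS
  case fiveVertex.triangle => exact mixed h.symm hb.symm hpart' hjS hiS
  case fiveVertex.fiveVertex =>
    by_cases h1 : ∃ x ∈ S, ¬ TriangleFreeOn (c.labelGraph i) (part S P x)
    · obtain ⟨x, hx, hxt⟩ := h1
      exact (hcard x hx).trans ((hpart x hx).card_le_of_not_triangleFreeOn hb hiS hjS hxt)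
    by_cases h2 : ∃ x ∈ S, ¬ TriangleFreeOn (c.labelGraph j) (part S P x)
    · obtain ⟨x, hx, hxt⟩ := h2
      exact (hcard' x hx).trans
        ((hpart' x hx).card_le_of_not_triangleFreeOn hb.symm hjS hiS hxt)
    push Not at h1 h2
    by_cases h3 : ∃ x ∈ S, ¬ EdgeFreeOn (c.labelGraph i) (part S P x)
    · obtain ⟨x, hx, hxe⟩ := h3
      exact (hcard x hx).trans ((hpart x hx).card_le_of_not_edgeFreeOn hb hiS hjS hxe (h1 x hx)
        (h2 x hx) (h.card_outside_le hb hjS h2 hx (hi x hx)))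
    by_cases h4 : ∃ x ∈ S, ¬ EdgeFreeOn (c.labelGraph j) (part S P x)
    · obtain ⟨x, hx, hxe⟩ := h4
      exact (hcard' x hx).trans ((hpart' x hx).card_le_of_not_edgeFreeOn hb.symm hjS hiS hxe
        (h2 x hx) (h1 x hx) (h.symm.card_outside_le hb.symm hiS h1 hx (hj x hx)))
    push Not at h3 h4
    have := h.card_le_mul hb h3 h4 (q := 17)
      fun Q hQ hQ' => card_le_seventeen hQ' (hiS.mono hQ) (hjS.mono hQ)
    have h6 : extremal a (r + 1 + 1) = 17 * extremal a r := h17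
    omega

/-- The upper bound: a Gallai coloring that avoids the forbidden graphs `ℓ` on `S` has at most
`bound ℓ` vertices in `S`. -/
theorem card_le_bound (hc : IsGallaiColoring c) (S : Finset V) :
    ∀ ℓ : K → Target, (∀ i, AvoidsOn (c.labelGraph i) S (ℓ i)) → S.card ≤ bound ℓ := by
  classical
  induction S using Finset.strongInduction with
  | H S ih =>
    intro ℓ hℓ
    by_cases hS : 2 ≤ S.card
    swap
    · have : 0 < bound ℓ := extremal_pos _ _
      omega
    obtain ⟨P, i, j, hP⟩ := exists_isGallaiPartition hc hS
    -- A part that is joined to its complement in a single color.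
    have hjoin : ∀ k, ∀ x ∈ S, (∀ y ∈ S, P y ≠ P x → (c.labelGraph k).Adj x y) →
        S.card ≤ bound ℓ := by
      intro k x hx hk
      refine card_le_bound_of_joined ih hℓ (i := k) (A := part S P x) (D := S \ part S P x) ?_
        (Finset.filter_subset _ _) Finset.sdiff_subset ⟨x, mem_part.2 ⟨hx, rfl⟩⟩ ?_ ?_
      · intro u hu v hv
        rw [Finset.mem_sdiff] at hv
        rw [mem_part] at hu
        have hne : P v ≠ P x := fun h => hv.2 (mem_part.2 ⟨hv.1, h⟩)
        exact hP.homogeneous x hx u hu.1 v hv.1 hu.2.symm hne.symm k (hk v hv.1 hne)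
      · obtain ⟨u, hu, v, hv, huv⟩ := hP.nontrivial
        by_cases hux : P u = P x
        · exact ⟨v, Finset.mem_sdiff.2
            ⟨hv, fun hvx => huv (hux.trans (mem_part.1 hvx).2.symm)⟩⟩
        · exact ⟨u, Finset.mem_sdiff.2 ⟨hu, fun hux' => hux (mem_part.1 hux').2⟩⟩
      · have := Finset.card_sdiff_add_card_eq_card (Finset.filter_subset (P · = P x) S)
        simp only [part]
        omega
    obtain ⟨x₀, hx₀, -⟩ := hP.nontrivial
    have hside : ∀ {i j : K}, IsGallaiPartition c S P i j →
        (∃ x ∈ S, ¬ (outside S P (c.labelGraph i) x).Nonempty) → S.card ≤ bound ℓ := by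
      rintro i j hP ⟨x, hx, hxe⟩
      refine hjoin j x hx fun y hy hyx => (hP.adj_or x hx y hy hyx.symm).resolve_left fun h => ?_
      exact hxe ⟨y, mem_outside.2 ⟨hy, hyx, h⟩⟩
    by_cases hi : ∃ x ∈ S, ¬ (outside S P (c.labelGraph i) x).Nonempty
    · exact hside hP hi
    by_cases hj : ∃ x ∈ S, ¬ (outside S P (c.labelGraph j) x).Nonempty
    · exact hside hP.symm hj
    by_cases hij : i = j
    · subst hij
      exact hjoin i x₀ hx₀ fun y hy hyx => (or_self_iff.1 (hP.adj_or x₀ hx₀ y hy hyx.symm))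
    push Not at hi hj
    exact hP.card_le_bound hij ih hℓ hi hj

end

/-! ### The lower bound -/

section LowerBound

variable {W : Type*}

/-- The graph `G` has no `K₄`. -/
def K4Free (G : SimpleGraph V) : Prop := ∀ x y z w, ¬ IsK4 G x y z w

/-- The graph `G` has no copy of `pendantK4`. -/
def PendantFree (G : SimpleGraph V) : Prop :=
  ∀ x y z w v, IsK4 G x y z w → G.Adj v x → v = y ∨ v = z ∨ v = w

/-- The graph `G` has no copy of the forbidden graph, which is `pendantK4` in the five-vertex
case. -/
def Avoids (G : SimpleGraph V) : Target → Prop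
  | .edge => G = ⊥
  | .triangle => ∀ x y z, G.Adj x y → G.Adj y z → ¬ G.Adj x z
  | .fiveVertex => PendantFree G

/-- The variant of `Avoids` with `K₄` in place of the five-vertex graph. -/
def StronglyAvoids (G : SimpleGraph V) : Target → Prop
  | .edge => G = ⊥
  | .triangle => ∀ x y z, G.Adj x y → G.Adj y z → ¬ G.Adj x z
  | .fiveVertex => K4Free G

variable {K : Type*}

lemma isGallaiColoring_iff {c : TopEdgeLabeling V K} : IsGallaiColoring c ↔
    ∀ i j k x y z, (c.labelGraph i).Adj x y → (c.labelGraph j).Adj y z →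
      (c.labelGraph k).Adj x z → i = j ∨ j = k ∨ i = k := by
  refine ⟨fun hc i j k x y z => hc.color_eq, fun h x y z hxy hyz hxz hne => ?_⟩
  have := h _ _ _ x y z ((TopEdgeLabeling.labelGraph_adj x y).2 ⟨hxy, rfl⟩)
    ((TopEdgeLabeling.labelGraph_adj y z).2 ⟨hyz, rfl⟩)
    ((TopEdgeLabeling.labelGraph_adj x z).2 ⟨hxz, rfl⟩)
  tauto

open scoped Classical in
/-- The coloring obtained from `c` by substituting a copy of the coloring `d` for each vertex. -/
noncomputable def lexColoring (c : TopEdgeLabeling V K) (d : TopEdgeLabeling W K) :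
    TopEdgeLabeling (V × W) K :=
  EdgeLabeling.mk (fun p q h => if hpq : p.1 = q.1 then
      d.get p.2 q.2 (fun h' => h (Prod.ext hpq h')) else c.get p.1 q.1 hpq) <| by
    intro p q h
    by_cases hpq : p.1 = q.1
    · simp only [hpq, dite_true]
      exact EdgeLabeling.get_comm _ _ _
    · simp only [hpq, Ne.symm hpq, dite_false]
      exact EdgeLabeling.get_comm _ _ _

variable {c : TopEdgeLabeling V K} {d : TopEdgeLabeling W K}

lemma lexColoring_adj {i : K} {p q : V × W} : ((lexColoring c d).labelGraph i).Adj p q ↔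
    (c.labelGraph i).Adj p.1 q.1 ∨ p.1 = q.1 ∧ (d.labelGraph i).Adj p.2 q.2 := by
  simp only [TopEdgeLabeling.labelGraph_adj, lexColoring, EdgeLabeling.get_mk]
  by_cases hpq : p.1 = q.1
  · by_cases h : p.2 = q.2
    · simp [hpq, h, Prod.ext_iff]
    · simp [hpq, h, Prod.ext_iff]
  · simp [hpq, Prod.ext_iff]

lemma isGallaiColoring_lexColoring (hc : IsGallaiColoring c) (hd : IsGallaiColoring d) :
    IsGallaiColoring (lexColoring c d) := by
  rw [isGallaiColoring_iff]
  intro i j k x y z hxy hyz hxz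
  rw [lexColoring_adj] at hxy hyz hxz
  rcases hxy with hxy | ⟨hxy, hxy'⟩ <;> rcases hyz with hyz | ⟨hyz, hyz'⟩ <;>
    rcases hxz with hxz | ⟨hxz, hxz'⟩
  · exact hc.color_eq hxy hyz hxz
  · exact .inl (color_unique hxy (hxz ▸ hyz.symm))
  · exact .inr (.inr (color_unique hxy (hyz ▸ hxz)))
  · exact (hxy.ne (hxz.trans hyz.symm)).elim
  · exact .inr (.inl (color_unique hyz (hxy ▸ hxz)))
  · exact (hyz.ne (hxy.symm.trans hxz)).elim
  · exact (hxz.ne (hxy.trans hyz)).elim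
  · exact hd.color_eq hxy' hyz' hxz'

/-- A color may occur in only one of the two factors of a lexicographic product. In the outer factor
even `K₄` has to be forbidden, as every vertex is replaced by several ones. -/
lemma avoids_lexColoring {i : K} {t : Target}
    (h : c.labelGraph i = ⊥ ∧ Avoids (d.labelGraph i) t ∨
      d.labelGraph i = ⊥ ∧ StronglyAvoids (c.labelGraph i) t) :
    Avoids ((lexColoring c d).labelGraph i) t := by
  rcases h with ⟨h0, h⟩ | ⟨h0, h⟩
  · have hadj : ∀ p q, ((lexColoring c d).labelGraph i).Adj p q →
        p.1 = q.1 ∧ (d.labelGraph i).Adj p.2 q.2 := fun p q hpq => by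
      rw [lexColoring_adj, h0] at hpq
      simpa only [SimpleGraph.bot_adj, false_or, false_and, and_false, or_false] using hpq
    cases t
    · ext p q
      have h' : d.labelGraph i = ⊥ := h
      rw [lexColoring_adj, h0, h']
      simp only [SimpleGraph.bot_adj, and_false, or_false]
    · exact fun x y z hxy hyz hxz =>
        h _ _ _ (hadj _ _ hxy).2 (hadj _ _ hyz).2 (hadj _ _ hxz).2
    · intro x y z w v hK hv
      have hv' := hadj _ _ hv
      have hxy := hadj _ _ hK.xy
      have hxz := hadj _ _ hK.xz
      have hxw := hadj _ _ hK.xw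
      rcases h _ _ _ _ _ ⟨hxy.2, hxz.2, hxw.2, (hadj _ _ hK.yz).2, (hadj _ _ hK.yw).2,
        (hadj _ _ hK.zw).2⟩ hv'.2 with h1 | h1 | h1
      · exact .inl (Prod.ext (hv'.1.trans hxy.1) h1)
      · exact .inr (.inl (Prod.ext (hv'.1.trans hxz.1) h1))
      · exact .inr (.inr (Prod.ext (hv'.1.trans hxw.1) h1))
  · have hadj : ∀ p q, ((lexColoring c d).labelGraph i).Adj p q →
        (c.labelGraph i).Adj p.1 q.1 := fun p q hpq => by
      rw [lexColoring_adj, h0] at hpq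
      simpa only [SimpleGraph.bot_adj, false_or, false_and, and_false, or_false] using hpq
    cases t
    · ext p q
      have h' : c.labelGraph i = ⊥ := h
      rw [lexColoring_adj, h0, h']
      simp only [SimpleGraph.bot_adj, and_false, or_false]
    · exact fun x y z hxy hyz hxz => h _ _ _ (hadj _ _ hxy) (hadj _ _ hyz) (hadj _ _ hxz)
    · intro x y z w v hK
      exact (h _ _ _ _ ⟨hadj _ _ hK.xy, hadj _ _ hK.xz, hadj _ _ hK.xw, hadj _ _ hK.yz,
        hadj _ _ hK.yw, hadj _ _ hK.zw⟩).elim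

open scoped Classical in
/-- The coloring whose edges have color `i` in `G` and color `j` in the complement of `G`. -/
noncomputable def twoColoring (G : SimpleGraph V) (i j : K) : TopEdgeLabeling V K :=
  EdgeLabeling.mk (fun x y _ => if G.Adj x y then i else j) (by simp [G.adj_comm])

lemma twoColoring_adj {G : SimpleGraph V} {i j k : K} {x y : V} :
    ((twoColoring G i j).labelGraph k).Adj x y ↔
      x ≠ y ∧ (G.Adj x y ∧ i = k ∨ ¬ G.Adj x y ∧ j = k) := by
  simp only [TopEdgeLabeling.labelGraph_adj, twoColoring, EdgeLabeling.get_mk, exists_prop]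
  by_cases h : G.Adj x y <;> simp [h]

lemma isGallaiColoring_twoColoring (G : SimpleGraph V) (i j : K) :
    IsGallaiColoring (twoColoring G i j) := by
  rw [isGallaiColoring_iff]
  intro i' j' k' x y z hxy hyz hxz
  rw [twoColoring_adj] at hxy hyz hxz
  rcases hxy.2 with ⟨-, h1⟩ | ⟨-, h1⟩ <;> rcases hyz.2 with ⟨-, h2⟩ | ⟨-, h2⟩ <;>
    rcases hxz.2 with ⟨-, h3⟩ | ⟨-, h3⟩ <;> simp [← h1, ← h2, ← h3]

lemma twoColoring_left {G : SimpleGraph V} {i j : K} (hij : i ≠ j) :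
    (twoColoring G i j).labelGraph i = G := by
  ext x y
  rw [twoColoring_adj]
  have : G.Adj x y → x ≠ y := fun h => h.ne
  have := hij.symm
  tauto

lemma twoColoring_right {G : SimpleGraph V} {i j : K} (hij : i ≠ j) :
    (twoColoring G i j).labelGraph j = Gᶜ := by
  ext x y
  rw [twoColoring_adj, SimpleGraph.compl_adj]
  tauto

lemma twoColoring_self {G : SimpleGraph V} {i : K} : (twoColoring G i i).labelGraph i = ⊤ := by
  ext x y
  rw [twoColoring_adj, SimpleGraph.top_adj]
  tauto

lemma twoColoring_other {G : SimpleGraph V} {i j k : K} (hik : k ≠ i) (hjk : k ≠ j) :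
    (twoColoring G i j).labelGraph k = ⊥ := by
  ext x y
  rw [twoColoring_adj]
  simp only [hik.symm, hjk.symm, and_false, or_false, SimpleGraph.bot_adj]

/-- The graph on `ℤ/17` whose edges are the pairs differing by a nonzero square. -/
def paleyGraph : SimpleGraph (Fin 17) :=
  circulantGraph (({1, 2, 4, 8, 9, 13, 15, 16} : Finset (Fin 17)) : Set (Fin 17))

/-- In a Cayley graph a `K₄` can be translated so that it contains zero. -/
lemma k4Free_of_sub {A : Type*} [AddCommGroup A] {G : SimpleGraph A} {D : Finset A}
    (hG : ∀ x y, G.Adj x y → y - x ∈ D)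
    (hD : ∀ a ∈ D, ∀ b ∈ D, b - a ∈ D → ∀ c ∈ D, c - a ∈ D → c - b ∉ D) : K4Free G := by
  intro x y z w hK
  have h1 := hG _ _ hK.yz
  have h2 := hG _ _ hK.yw
  have h3 := hG _ _ hK.zw
  rw [← sub_sub_sub_cancel_right _ _ x] at h1 h2 h3
  exact hD _ (hG _ _ hK.xy) _ (hG _ _ hK.xz) h1 _ (hG _ _ hK.xw) h2 h3

lemma k4Free_paleyGraph : K4Free paleyGraph := by
  refine k4Free_of_sub (D := {1, 2, 4, 8, 9, 13, 15, 16}) ?_ (by decide)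
  intro x y h
  simp only [paleyGraph, circulantGraph_adj, Finset.mem_coe] at h
  have hneg : ∀ d ∈ ({1, 2, 4, 8, 9, 13, 15, 16} : Finset (Fin 17)),
      -d ∈ ({1, 2, 4, 8, 9, 13, 15, 16} : Finset (Fin 17)) := by decide
  rcases h.2 with h | h
  · rw [← neg_sub]
    exact hneg _ h
  · exact h

lemma k4Free_compl_paleyGraph : K4Free paleyGraphᶜ := by
  refine k4Free_of_sub (D := {3, 5, 6, 7, 10, 11, 12, 14}) ?_ (by decide)
  intro x y h
  simp only [paleyGraph, SimpleGraph.compl_adj, circulantGraph_adj, Finset.mem_coe, not_and,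
    not_or] at h
  have hd : ∀ d : Fin 17, d ≠ 0 → d ∉ ({1, 2, 4, 8, 9, 13, 15, 16} : Finset (Fin 17)) →
      d ∈ ({3, 5, 6, 7, 10, 11, 12, 14} : Finset (Fin 17)) := by decide
  exact hd _ (sub_ne_zero.2 h.1.symm) (h.2 h.1).2

lemma cycleGraph_five_triangleFree (x y z : Fin 5) : (cycleGraph 5).Adj x y →
    (cycleGraph 5).Adj y z → ¬ (cycleGraph 5).Adj x z := by
  revert x y z
  decide

lemma compl_cycleGraph_five_triangleFree (x y z : Fin 5) : (cycleGraph 5)ᶜ.Adj x y →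
    (cycleGraph 5)ᶜ.Adj y z → ¬ (cycleGraph 5)ᶜ.Adj x z := by
  revert x y z
  decide

variable [Fintype K] [DecidableEq K]

/-- There is a Gallai coloring on `bound ℓ` vertices that avoids the forbidden graphs `ℓ`. -/
def IsAttained (ℓ : K → Target) : Prop :=
  ∃ (W : Type) (_ : Fintype W) (c : TopEdgeLabeling W K), Fintype.card W = bound ℓ ∧
    IsGallaiColoring c ∧ ∀ i, Avoids (c.labelGraph i) (ℓ i)

/-- Substitution into a two-coloring for the colors `i` and `j`. -/
lemma IsAttained.of_twoColoring {ℓ : K → Target} {i j : K} {n : ℕ} {G : SimpleGraph (Fin n)}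
    (h : IsAttained (Function.update (Function.update ℓ i .edge) j .edge))
    (hn : bound ℓ = n * bound (Function.update (Function.update ℓ i .edge) j .edge))
    (hi : StronglyAvoids ((twoColoring G i j).labelGraph i) (ℓ i))
    (hj : StronglyAvoids ((twoColoring G i j).labelGraph j) (ℓ j)) : IsAttained ℓ := by
  obtain ⟨W, hW, d, hcard, hd, hav⟩ := h
  refine ⟨Fin n × W, inferInstance, lexColoring (twoColoring G i j) d, ?_,
    isGallaiColoring_lexColoring (isGallaiColoring_twoColoring G i j) hd, fun k => ?_⟩
  · rw [Fintype.card_prod, hcard, Fintype.card_fin, hn]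
  · have hk := hav k
    apply avoids_lexColoring
    by_cases hkj : k = j
    · subst hkj
      exact .inr ⟨by simpa [Avoids] using hk, hj⟩
    by_cases hki : k = i
    · subst hki
      exact .inr ⟨by simpa [Avoids, hkj] using hk, hi⟩
    · exact .inl ⟨twoColoring_other hki hkj, by simpa [hkj, hki] using hk⟩

lemma count_update_update_lt {ℓ : K → Target} {i : K} (j : K) (hi : ℓ i ≠ .edge) :
    (Finset.univ.filter fun k =>
      Function.update (Function.update ℓ i .edge) j .edge k ≠ .edge).card <
      (Finset.univ.filter fun k => ℓ k ≠ .edge).card := by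
  refine Finset.card_lt_card ((Finset.ssubset_iff_of_subset fun k hk => ?_).2 ⟨i, by simpa, ?_⟩)
  · simp only [Finset.mem_filter, Finset.mem_univ, true_and, Function.update_apply] at hk ⊢
    split_ifs at hk <;> simp_all
  · simp [Function.update_apply]

/-- The lower bound. Pairs of colors with the same forbidden graph contribute a pentagon or a Paley
coloring on 17 vertices, a last triangle color an edge, and a last five-vertex color a
monochromatic `K₄`, which has to be innermost. -/
theorem isAttained (ℓ : K → Target) : IsAttained ℓ := by
  induction hN : (Finset.univ.filter fun k => ℓ k ≠ .edge).card using Nat.strong_induction_on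
    generalizing ℓ with
  | h N ih =>
    subst hN
    by_cases h1 : ∃ i j, i ≠ j ∧ ℓ i = .triangle ∧ ℓ j = .triangle
    · obtain ⟨i, j, hij, hi, hj⟩ := h1
      refine (ih _ (count_update_update_lt (i := i) j (by simp [hi])) _ rfl).of_twoColoring
        (G := cycleGraph 5) ?_ ?_ ?_
      · have h := bound_update_update ℓ hij (ℓ i) (ℓ j)
        rw [Function.update_eq_self, Function.update_eq_self] at h
        rw [h, bound_update_update ℓ hij]
        simp [hi, hj, extremal, triangleFactor, mul_assoc]
      · rw [hi, twoColoring_left hij]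
        exact cycleGraph_five_triangleFree
      · rw [hj, twoColoring_right hij]
        exact compl_cycleGraph_five_triangleFree
    by_cases h2 : ∃ i j, i ≠ j ∧ ℓ i = .fiveVertex ∧ ℓ j = .fiveVertex
    · obtain ⟨i, j, hij, hi, hj⟩ := h2
      refine (ih _ (count_update_update_lt (i := i) j (by simp [hi])) _ rfl).of_twoColoring
        (G := paleyGraph) ?_ ?_ ?_
      · have h := bound_update_update ℓ hij (ℓ i) (ℓ j)
        rw [Function.update_eq_self, Function.update_eq_self] at h
        rw [h, bound_update_update ℓ hij]
        simp [hi, hj, extremal, fiveVertexFactor, mul_left_comm]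
      · rw [hi, twoColoring_left hij]
        exact k4Free_paleyGraph
      · rw [hj, twoColoring_right hij]
        exact k4Free_compl_paleyGraph
    by_cases h3 : ∃ i, ℓ i = .triangle
    · obtain ⟨i, hi⟩ := h3
      have hcount : count (Function.update ℓ i .edge) .triangle = 0 := by
        rw [count, Finset.card_eq_zero, Finset.filter_eq_empty_iff]
        intro k _ hk
        by_cases hki : k = i
        · simp [hki] at hk
        · exact h1 ⟨k, i, hki, by simpa [hki] using hk, hi⟩
      have htop : StronglyAvoids
          ((twoColoring (⊤ : SimpleGraph (Fin 2)) i i).labelGraph i) (ℓ i) := by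
        rw [hi, twoColoring_self]
        intro x y z hxy hyz hxz
        simp only [SimpleGraph.top_adj] at hxy hyz hxz
        omega
      refine (ih _ (count_update_update_lt (i := i) i (by simp [hi])) _ rfl).of_twoColoring
        (G := (⊤ : SimpleGraph (Fin 2))) ?_ htop htop
      have h := bound_update ℓ i (ℓ i)
      rw [Function.update_eq_self] at h
      rw [h, Function.update_idem, bound, hcount]
      simp [hi, extremal, triangleFactor]
    push Not at h3
    have htri : count ℓ .triangle = 0 := by
      rw [count, Finset.card_eq_zero, Finset.filter_eq_empty_iff]
      exact fun k _ => h3 k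
    by_cases h4 : ∃ i, ℓ i = .fiveVertex
    · obtain ⟨i, hi⟩ := h4
      have hcount : count ℓ .fiveVertex = 1 := by
        rw [count, Finset.card_eq_one]
        refine ⟨i, Finset.ext fun k => ?_⟩
        simp only [Finset.mem_filter, Finset.mem_univ, true_and, Finset.mem_singleton]
        exact ⟨fun hk => by_contra fun hki => h2 ⟨k, i, hki, hk, hi⟩, fun hk => hk ▸ hi⟩
      refine ⟨Fin 4, inferInstance, twoColoring ⊤ i i, ?_, isGallaiColoring_twoColoring _ _ _,
        fun k => ?_⟩
      · simp [bound, htri, hcount, extremal, triangleFactor, fiveVertexFactor]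
      · by_cases hk : k = i
        · subst hk
          rw [twoColoring_self, hi]
          rintro x y z w v ⟨xy, xz, xw, yz, yw, zw⟩ hv
          simp only [SimpleGraph.top_adj] at xy xz xw yz yw zw hv
          omega
        · rw [twoColoring_other hk hk]
          cases ht : ℓ k
          · rfl
          · exact (h3 k ht).elim
          · exact (h2 ⟨k, i, hk, ht, hi⟩).elim
    · push Not at h4
      have hfive : count ℓ .fiveVertex = 0 := by
        rw [count, Finset.card_eq_zero, Finset.filter_eq_empty_iff]
        exact fun k _ => h4 k
      refine ⟨Fin 1, inferInstance, EdgeLabeling.mk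
        (fun x y h => (h (Subsingleton.elim x y)).elim)
        (fun x y h => (h (Subsingleton.elim x y)).elim), ?_, ?_, fun k => ?_⟩
      · simp [bound, htri, hfive, extremal, triangleFactor, fiveVertexFactor]
      · exact fun x y _ h => (h (Subsingleton.elim x y)).elim
      · have : ℓ k = .edge := by
          cases ht : ℓ k
          exacts [rfl, (h3 k ht).elim, (h4 k ht).elim]
        rw [this]
        exact Subsingleton.elim _ _

end LowerBound

/-! ### Gallai–Ramsey numbers -/

section Numbers

lemma pendantK4_le_twoJoinedK4 : pendantK4 ≤ twoJoinedK4 :=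
  fromEdgeSet_mono (by
    intro e he
    simp only [Set.mem_insert_iff, Set.mem_singleton_iff] at he ⊢
    tauto)

lemma twoJoinedK4_isContained {x y z w v : V} (hK : IsK4 G x y z w) (hz : v ≠ z) (hw : v ≠ w)
    (hx : G.Adj v x) (hy : G.Adj v y) : twoJoinedK4 ⊑ G := by
  obtain ⟨xy, xz, xw, yz, yw, zw⟩ := hK
  refine ⟨⟨⟨![x, y, z, w, v], ?_⟩, ?_⟩⟩
  · intro a b hab
    fin_cases a <;> fin_cases b <;> simp [twoJoinedK4] at hab ⊢ <;>
      first | assumption | (apply SimpleGraph.Adj.symm; assumption)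
  · have := xy.ne
    have := xz.ne
    have := xw.ne
    have := yz.ne
    have := yw.ne
    have := zw.ne
    have := hx.ne
    have := hy.ne
    intro a b hab
    fin_cases a <;> fin_cases b <;> simp at hab ⊢ <;> simp_all

lemma PendantFree.not_isContained (h : PendantFree G) : ¬ pendantK4 ⊑ G := by
  rintro ⟨f⟩
  have hadj : ∀ a b, pendantK4.Adj a b → G.Adj (f a) (f b) := fun a b hab => f.toHom.map_adj hab
  have hinj : ∀ {a b}, f a = f b → a = b := fun hab => f.injective hab
  have := h (f 0) (f 1) (f 2) (f 3) (f 4) ⟨hadj 0 1 (by simp [pendantK4]),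
    hadj 0 2 (by simp [pendantK4]), hadj 0 3 (by simp [pendantK4]),
    hadj 1 2 (by simp [pendantK4]), hadj 1 3 (by simp [pendantK4]),
    hadj 2 3 (by simp [pendantK4])⟩ (hadj 4 0 (by simp [pendantK4]))
  rcases this with h | h | h
  · exact absurd (hinj h) (by decide)
  · exact absurd (hinj h) (by decide)
  · exact absurd (hinj h) (by decide)

lemma completeGraph_isContained {x y z : V} (hxy : G.Adj x y) (hyz : G.Adj y z)
    (hxz : G.Adj x z) : completeGraph (Fin 3) ⊑ G := by
  refine ⟨⟨⟨![x, y, z], ?_⟩, ?_⟩⟩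
  · intro a b hab
    fin_cases a <;> fin_cases b <;> simp at hab ⊢ <;>
      first | assumption | (apply SimpleGraph.Adj.symm; assumption)
  · have := hxy.ne
    have := hyz.ne
    have := hxz.ne
    intro a b hab
    fin_cases a <;> fin_cases b <;> simp at hab ⊢ <;> simp_all

lemma not_completeGraph_isContained
    (h : ∀ x y z, G.Adj x y → G.Adj y z → ¬ G.Adj x z) : ¬ completeGraph (Fin 3) ⊑ G := by
  rintro ⟨f⟩
  have hadj : ∀ a b, a ≠ b → G.Adj (f a) (f b) := fun a b hab => f.toHom.map_adj hab
  exact h (f 0) (f 1) (f 2) (hadj 0 1 (by decide)) (hadj 1 2 (by decide)) (hadj 0 2 (by decide))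

lemma labelGraph_pullback_isContained {W K : Type*} (c : TopEdgeLabeling V K) (f : W ↪ V) (i : K) :
    EdgeLabeling.labelGraph (c.pullback f) i ⊑ c.labelGraph i := by
  refine ⟨⟨⟨f, fun {a b} hab => ?_⟩, f.injective⟩⟩
  rw [TopEdgeLabeling.labelGraph_adj] at hab ⊢
  obtain ⟨hne, hab⟩ := hab
  exact ⟨f.injective.ne hne, hab⟩

lemma isGallaiColoring_pullback {W K : Type*} {c : TopEdgeLabeling V K} (hc : IsGallaiColoring c)
    (f : W ↪ V) : IsGallaiColoring (c.pullback f) :=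
  fun x y z hxy hyz hxz =>
    hc (f x) (f y) (f z) (f.injective.ne hxy) (f.injective.ne hyz) (f.injective.ne hxz)

/-- The forbidden graphs of `trianglesAnd k r H`. -/
def target (k r : ℕ) (i : Fin k) : Target := if (i : ℕ) < r then .fiveVertex else .triangle

lemma bound_target {k r : ℕ} (hr : r ≤ k) : bound (target k r) = extremal (k - r) r := by
  have h1 : count (target k r) .fiveVertex = r := by
    have : (Finset.univ.filter fun i => target k r i = .fiveVertex) =
        Finset.univ.filter fun i : Fin k => (i : ℕ) < r := by
      ext i
      simp [target]
    rw [count, this, Fin.card_filter_val_lt, min_eq_right hr]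
  have h2 : count (target k r) .triangle + count (target k r) .fiveVertex = k := by
    have : (Finset.univ.filter fun i => target k r i = .fiveVertex) =
        Finset.univ.filter fun i => ¬ target k r i = .triangle := by
      ext i
      by_cases h : (i : ℕ) < r <;> simp [target, h]
    rw [count, count, this, Finset.card_filter_add_card_filter_not, Finset.card_univ,
      Fintype.card_fin]
  rw [bound, h1, show count (target k r) .triangle = k - r by omega]

theorem isGallaiRamseyNumber {H : SimpleGraph (Fin 5)} (hH : H = pendantK4 ∨ H = twoJoinedK4)
    {k r : ℕ} (hr : r ≤ k) :
    IsGallaiRamseyNumber k (trianglesAnd k r H) (extremal (k - r) r + 1) := by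
  have hle : pendantK4 ≤ H ∧ H ≤ twoJoinedK4 := by
    rcases hH with rfl | rfl
    exacts [⟨le_rfl, pendantK4_le_twoJoinedK4⟩, ⟨pendantK4_le_twoJoinedK4, le_rfl⟩]
  rw [← bound_target hr]
  constructor
  · intro c hc
    by_contra hno
    have := card_le_bound hc Finset.univ (target k r) fun i => by
      have hi : ¬ (trianglesAnd k r H i).2 ⊑ c.labelGraph i := fun hi => hno ⟨i, hi⟩
      by_cases h : (i : ℕ) < r
      · rw [show trianglesAnd k r H i = ⟨5, H⟩ from if_pos h] at hi
        simp only [target, h, if_true]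
        intro x y z w v _ _ _ _ _ hK hz hw hx hy
        exact hi ((twoJoinedK4_isContained hK hz hw hx hy).mono_left hle.2)
      · rw [show trianglesAnd k r H i = ⟨3, completeGraph (Fin 3)⟩ from if_neg h] at hi
        simp only [target, h, if_false]
        intro x _ y _ z _ hxy hyz hxz
        exact hi (completeGraph_isContained hxy hyz hxz)
    rw [Finset.card_univ, Fintype.card_fin] at this
    omega
  · intro n hn
    by_contra! hlt
    obtain ⟨W, _, c, hW, hc, hav⟩ := isAttained (target k r)
    obtain ⟨f⟩ : Nonempty (Fin n ↪ W) :=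
      Function.Embedding.nonempty_of_card_le (by rw [hW, Fintype.card_fin]; omega)
    obtain ⟨i, hi⟩ := hn (c.pullback f) (isGallaiColoring_pullback hc f)
    replace hi := hi.trans (labelGraph_pullback_isContained c f i)
    have hi' := hav i
    by_cases h : (i : ℕ) < r
    · rw [show trianglesAnd k r H i = ⟨5, H⟩ from if_pos h] at hi
      simp only [target, h, if_true] at hi'
      exact PendantFree.not_isContained hi' (hi.mono_left hle.1)
    · rw [show trianglesAnd k r H i = ⟨3, completeGraph (Fin 3)⟩ from if_neg h] at hi
      simp only [target, h, if_false] at hi'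
      exact not_completeGraph_isContained hi' hi

lemma triangleFactor_two_mul (m : ℕ) : triangleFactor (2 * m) = 5 ^ m := by
  induction m with
  | zero => rfl
  | succ m ih => rw [Nat.mul_succ, triangleFactor, ih, pow_succ, mul_comm]

lemma triangleFactor_two_mul_add_one (m : ℕ) : triangleFactor (2 * m + 1) = 2 * 5 ^ m := by
  induction m with
  | zero => rfl
  | succ m ih =>
    rw [show 2 * (m + 1) + 1 = 2 * m + 1 + 2 by ring, triangleFactor, ih]
    ring

lemma fiveVertexFactor_two_mul (m : ℕ) : fiveVertexFactor (2 * m) = 17 ^ m := by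
  induction m with
  | zero => rfl
  | succ m ih => rw [Nat.mul_succ, fiveVertexFactor, ih, pow_succ, mul_comm]

lemma fiveVertexFactor_two_mul_add_one (m : ℕ) : fiveVertexFactor (2 * m + 1) = 4 * 17 ^ m := by
  induction m with
  | zero => rfl
  | succ m ih =>
    rw [show 2 * (m + 1) + 1 = 2 * m + 1 + 2 by ring, fiveVertexFactor, ih]
    ring

end Numbers

end GallaiRamsey

open GallaiRamsey in
theorem theorem1p4 (H : SimpleGraph (Fin 5)) (hH : H = pendantK4 ∨ H = twoJoinedK4)
    (k r : ℕ) (hk : 1 ≤ k) (hr : r ≤ k) :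
    (Even (k - r) → Even r →
      IsGallaiRamseyNumber k (trianglesAnd k r H)
        (5 ^ ((k - r) / 2) * 17 ^ (r / 2) + 1)) ∧
    (Odd (k - r) → Even r →
      IsGallaiRamseyNumber k (trianglesAnd k r H)
        (2 * 5 ^ ((k - r - 1) / 2) * 17 ^ (r / 2) + 1)) ∧
    (Odd (k - r) → Odd r →
      IsGallaiRamseyNumber k (trianglesAnd k r H)
        (8 * 5 ^ ((k - r - 1) / 2) * 17 ^ ((r - 1) / 2) + 1)) ∧
    (Even (k - r) → Odd r →
      IsGallaiRamseyNumber k (trianglesAnd k r H)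
        (4 * 5 ^ ((k - r) / 2) * 17 ^ ((r - 1) / 2) + 1)) := by
  have main := isGallaiRamseyNumber hH hr
  have heven : ∀ {n : ℕ}, Even n → n = 2 * (n / 2) := fun h => (Nat.two_mul_div_two_of_even h).symm
  have hodd : ∀ {n : ℕ}, Odd n → n = 2 * ((n - 1) / 2) + 1 := fun h => by
    obtain ⟨m, rfl⟩ := h
    omega
  have ha : Even (k - r) → triangleFactor (k - r) = 5 ^ ((k - r) / 2) := fun h => by
    conv_lhs => rw [heven h, triangleFactor_two_mul]
  have ha' : Odd (k - r) → triangleFactor (k - r) = 2 * 5 ^ ((k - r - 1) / 2) := fun h => by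
    conv_lhs => rw [hodd h, triangleFactor_two_mul_add_one]
  have hb : Even r → fiveVertexFactor r = 17 ^ (r / 2) := fun h => by
    conv_lhs => rw [heven h, fiveVertexFactor_two_mul]
  have hb' : Odd r → fiveVertexFactor r = 4 * 17 ^ ((r - 1) / 2) := fun h => by
    conv_lhs => rw [hodd h, fiveVertexFactor_two_mul_add_one]
  refine ⟨fun h h' => ?_, fun h h' => ?_, fun h h' => ?_, fun h h' => ?_⟩
  · rw [extremal, ha h, hb h'] at main
    exact main
  · rw [extremal, ha' h, hb h'] at main
    exact main
  · rw [extremal, ha' h, hb' h'] at main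
    convert main using 2
    ring
  · rw [extremal, ha h, hb' h'] at main
    convert main using 2
    ring
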